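/- **Theorem.** Let $n\in\mathbb N$, let $B$ be a real $n\times n$ matrix, let $\Lambda\subset\mathbb R^n$ be a lattice (a discrete subgroup spanning $\mathbb R^n$), let $A_\Lambda$ be an invertible real $n\times n$ matrix with $\Lambda=A_\Lambda\mathbb Z^n$, and let $U\subset\mathbb R^n$ be a bounded open neighbourhood of the origin such that the sets $\lambda+U$, $\lambda\in\Lambda$, are pairwise disjoint. Write $T_xf(t)=f(t-x)$, $M_\xi f(t)=f(t)e^{2\pi i t\cdot\xi}$ and $$T^B_xf(t):=T_xM_{-Bx}f(t)=f(t-x)\,e^{-2\pi i\,Bx\cdot(t-x)}.$$ A *TMIB* on $\mathbb R^n$ is a complex Banach space $E$ with dense continuous inclusions $\mathcal S(\mathbb R^n)\hookrightarrow E\hookrightarrow\mathcal S'(\mathbb R^n)$ such that $T_x(E)\subseteq E$ and $M_\xi(E)\subseteq E$ for all $x,\xi\in\mathbb R^n$, and such that, for some $C_0,C_1,\tau_0,\tau_1>0$, one has $\|T_x\|_{\mathcal L(E)}\le C_0(1+|x|)^{\tau_0}$ and $\|M_{-\xi}\|_{\mathcal L(E)}\le C_1(1+|\xi|)^{\tau_1}$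 for all $x,\xi\in\mathbb R^n$. A *DTMIB* on $\mathbb R^n$ is the strong dual $E=E_0'$ of a TMIB $E_0$ on $\mathbb R^n$; it is regarded as a subspace of $\mathcal S'(\mathbb R^n)$ by restricting functionals to $\mathcal S(\mathbb R^n)$, and its weak-$*$ topology is the one induced by $E_0$. Let $E$ be a TMIB or a DTMIB on $\mathbb R^n$ and let $\chi\in\mathcal D(U)\setminus\{0\}$, i.e. $\chi$ is a non-zero complex-valued smooth function on $\mathbb R^n$ with compact support contained in $U$. For $c=(c_\lambda)_{\lambda\in\Lambda}\in\mathbb C^\Lambda$ put $$S_\chi(c):=\sum_{\lambda\in\Lambda}c_\lambda T^B_\lambda\chi\in\mathcal D'(\mathbb R^n)$$ (the sum is locally finite), and let $E^B_d(\Lambda)=E^B_{d,\chi}(\Lambda):=\{c\in\mathbb C^\Lambda : S_\chi(c)\in E\}$. Then for every $c\in E^B_d(\Lambda)$ the series $\sum_{\lambda\in\Lambda}c_\lambda T^B_\lambda\chi$ is Cesàro summable to $S_\chi(c)$, that is, $$\lim_{N\to\infty}\ \sum_{\substack{m\in\mathbb Z^n\\ |m_j|<N,\ 1\le j\le n}}\Big(1-\frac{|m_1|}{N}\Big)\cdots\Big(1-\frac{|m_n|}{N}\Big)\,c_{A_\Lambda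 m}\,T^B_{A_\Lambda m}\chi \;=\; S_\chi(c),$$ where the limit holds in the norm of $E$ if $E$ is a TMIB, and in the weak-$*$ topology of $E$ if $E$ is a DTMIB. -/

import Mathlib

open MeasureTheory Filter Topology TopologicalSpace
open scoped SchwartzMap Distributions ContDiff Pointwise

noncomputable section

namespace GaborTMIB

/-- The Euclidean space `ℝⁿ`. -/
abbrev Rn (n : ℕ) : Type := EuclideanSpace ℝ (Fin n)

/-- The character `t ↦ exp (2πi t·ξ)` of `ℝⁿ`. -/
def character {n : ℕ} (ξ : Rn n) (t : Rn n) : ℂ :=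
  Complex.exp (2 * Real.pi * Complex.I * (inner ℝ t ξ : ℝ))

lemma character_hasTemperateGrowth {n : ℕ} (ξ : Rn n) :
    (character ξ).HasTemperateGrowth := by
  have h1 : (fun s : ℝ => Complex.exp (Complex.I * (s : ℂ))).HasTemperateGrowth := by
    have hd : ∀ k : ℕ, iteratedDeriv k (fun s : ℝ => Complex.exp (Complex.I * (s : ℂ)))
        = fun s : ℝ => Complex.I ^ k * Complex.exp (Complex.I * (s : ℂ)) := by
      intro k
      induction k with
      | zero => simp
      | succ k ih =>
        rw [iteratedDeriv_succ, ih]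
        funext s
        have hs : HasDerivAt (fun s : ℝ => Complex.I * (s : ℂ)) (Complex.I * 1) s :=
          (Complex.ofRealCLM.hasDerivAt (x := s)).const_mul Complex.I
        have := (hs.cexp.const_mul (Complex.I ^ k)).deriv
        rw [this]
        ring
    refine ⟨?_, fun k => ⟨0, 1, fun s => ?_⟩⟩
    · exact Complex.contDiff_exp.comp (contDiff_const.mul Complex.ofRealCLM.contDiff)
    · rw [norm_iteratedFDeriv_eq_norm_iteratedDeriv, hd k]
      simp [Complex.norm_exp]
  have h2 : (fun t : Rn n => (2 * Real.pi) * inner ℝ t ξ).HasTemperateGrowth := by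
    fun_prop
  have h3 := h1.comp h2
  have h4 : (character ξ) = (fun s : ℝ => Complex.exp (Complex.I * (s : ℂ))) ∘
      (fun t : Rn n => (2 * Real.pi) * inner ℝ t ξ) := by
    funext t
    simp only [character, Function.comp_apply]
    push_cast
    congr 1
    ring
  rw [h4]
  exact h3

/-- Translation `T_x f(t) = f(t - x)` on `𝓢(ℝⁿ)`. -/
def translate {n : ℕ} (x : Rn n) : 𝓢(Rn n, ℂ) →L[ℂ] 𝓢(Rn n, ℂ) :=
  SchwartzMap.compSubConstCLM ℂ x

/-- Modulation `M_ξ f(t) = f(t) exp (2πi t·ξ)` on `𝓢(ℝⁿ)`. -/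
def modulate {n : ℕ} (ξ : Rn n) : 𝓢(Rn n, ℂ) →L[ℂ] 𝓢(Rn n, ℂ) :=
  SchwartzMap.smulLeftCLM ℂ (character ξ)

lemma translate_apply {n : ℕ} (x : Rn n) (f : 𝓢(Rn n, ℂ)) (t : Rn n) :
    translate x f t = f (t - x) := rfl

lemma modulate_apply {n : ℕ} (ξ : Rn n) (f : 𝓢(Rn n, ℂ)) (t : Rn n) :
    modulate ξ f t = character ξ t * f t := by
  simp [modulate, SchwartzMap.smulLeftCLM_apply_apply (character_hasTemperateGrowth ξ)]

/-- The twisted translation `T^B_x f(t) = T_x M_{-Bx} f(t) = f(t - x) exp (-2πi Bx·(t - x))`. -/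
def twistedTranslate {n : ℕ} (B : Matrix (Fin n) (Fin n) ℝ) (x : Rn n) :
    𝓢(Rn n, ℂ) →L[ℂ] 𝓢(Rn n, ℂ) :=
  (translate x).comp (modulate (-(Matrix.toEuclideanLin B x)))

lemma twistedTranslate_apply {n : ℕ} (B : Matrix (Fin n) (Fin n) ℝ) (x : Rn n)
    (f : 𝓢(Rn n, ℂ)) (t : Rn n) :
    twistedTranslate B x f t = f (t - x) *
      Complex.exp (-(2 * Real.pi * Complex.I *
        (inner ℝ (Matrix.toEuclideanLin B x) (t - x) : ℝ))) := by
  simp only [twistedTranslate, ContinuousLinearMap.comp_apply, translate_apply, modulate_apply,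
    character, inner_neg_right, real_inner_comm]
  rw [mul_comm]
  congr 2
  push_cast
  ring

/-- The tempered distributions `𝓢'(ℝⁿ)`, with the strong topology
(uniform convergence on bounded sets of `𝓢(ℝⁿ)`). -/
abbrev TempDist (n : ℕ) : Type := StrongDual ℂ 𝓢(Rn n, ℂ)

/-- Translation on `𝓢'(ℝⁿ)`, by duality: `⟨T_x u, φ⟩ = ⟨u, T_{-x} φ⟩`. -/
def translateDist {n : ℕ} (x : Rn n) (u : TempDist n) : TempDist n :=
  u.comp (translate (-x))

/-- Modulation on `𝓢'(ℝⁿ)`, by duality: `⟨M_ξ u, φ⟩ = ⟨u, M_ξ φ⟩`. -/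
def modulateDist {n : ℕ} (ξ : Rn n) (u : TempDist n) : TempDist n :=
  u.comp (modulate ξ)

/-- A *translation-modulation invariant Banach space of distributions* (TMIB) on `ℝⁿ`: a Banach
space `E` with dense continuous inclusions `𝓢(ℝⁿ) ↪ E ↪ 𝓢'(ℝⁿ)`, invariant under all
translations and modulations, whose operator norms on `E` are polynomially bounded.
The inclusions are the maps `incl` and `emb`; their composition is the canonical inclusion
of `𝓢(ℝⁿ)` into `𝓢'(ℝⁿ)`. -/
structure TMIB (n : ℕ) (E : Type*) [NormedAddCommGroup E] [NormedSpace ℂ E]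
    [CompleteSpace E] where
  /-- the continuous inclusion `𝓢(ℝⁿ) → E` -/
  incl : 𝓢(Rn n, ℂ) →L[ℂ] E
  /-- the continuous inclusion `E → 𝓢'(ℝⁿ)` -/
  emb : E →L[ℂ] TempDist n
  denseRange_incl : DenseRange incl
  injective_emb : Function.Injective emb
  emb_incl : ∀ φ ψ : 𝓢(Rn n, ℂ), emb (incl φ) ψ = ∫ t, φ t * ψ t
  translate_mem : ∀ (x : Rn n) (e : E), ∃ f : E, emb f = translateDist x (emb e)
  modulate_mem : ∀ (ξ : Rn n) (e : E), ∃ f : E, emb f = modulateDist ξ (emb e)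
  translate_bound : ∃ C > (0 : ℝ), ∃ τ > (0 : ℝ), ∀ (x : Rn n) (e f : E),
    emb f = translateDist x (emb e) → ‖f‖ ≤ C * (1 + ‖x‖) ^ τ * ‖e‖
  modulate_bound : ∃ C > (0 : ℝ), ∃ τ > (0 : ℝ), ∀ (ξ : Rn n) (e f : E),
    emb f = modulateDist (-ξ) (emb e) → ‖f‖ ≤ C * (1 + ‖ξ‖) ^ τ * ‖e‖

namespace TMIB

variable {n : ℕ} {E : Type*} [NormedAddCommGroup E] [NormedSpace ℂ E] [CompleteSpace E]

/-- The inclusion `E' → 𝓢'(ℝⁿ)` of the strong dual of a TMIB `E` (that is, of a DTMIB):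
a functional on `E` is restricted to `𝓢(ℝⁿ)`. -/
def dualEmb (h : TMIB n E) : StrongDual ℂ E →L[ℂ] TempDist n :=
  ContinuousLinearMap.precomp ℂ h.incl

/-- The inclusion `𝓢(ℝⁿ) → E'` for a TMIB `E`: a Schwartz function `φ` acts on
`e ∈ E ⊆ 𝓢'(ℝⁿ)` by `e ↦ ⟨e, φ⟩`. -/
def dualIncl (h : TMIB n E) (φ : 𝓢(Rn n, ℂ)) : StrongDual ℂ E :=
  { toFun := fun e => h.emb e φ
    map_add' := fun e f => by simp
    map_smul' := fun a e => by simp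
    cont := (continuous_eval_const φ).comp h.emb.continuous }

lemma dualEmb_apply (h : TMIB n E) (e' : StrongDual ℂ E) (φ : 𝓢(Rn n, ℂ)) :
    h.dualEmb e' φ = e' (h.incl φ) := rfl

lemma dualIncl_apply (h : TMIB n E) (φ : 𝓢(Rn n, ℂ)) (e : E) :
    h.dualIncl φ e = h.emb e φ := rfl

/-- The two inclusions compose to the canonical inclusion `𝓢(ℝⁿ) → 𝓢'(ℝⁿ)`. -/
lemma dualEmb_dualIncl (h : TMIB n E) (φ ψ : 𝓢(Rn n, ℂ)) :
    h.dualEmb (h.dualIncl φ) ψ = ∫ t, φ t * ψ t := by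
  rw [dualEmb_apply, dualIncl_apply, h.emb_incl]
  simp only [mul_comm]

lemma dualEmb_injective (h : TMIB n E) : Function.Injective h.dualEmb := by
  intro a b hab
  have hfun : (a : E → ℂ) = b := by
    refine h.denseRange_incl.equalizer a.continuous b.continuous ?_
    funext φ
    simpa [dualEmb_apply] using congrArg (fun u : TempDist n => u φ) hab
  exact DFunLike.coe_injective hfun

end TMIB

/-- A test function in `𝓓(U)`, seen as an element of `𝓢(ℝⁿ)`. -/
def testToSchwartz {n : ℕ} {U : Opens (Rn n)} (χ : 𝓓(U, ℂ)) : 𝓢(Rn n, ℂ) :=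
  χ.hasCompactSupport.toSchwartzMap χ.contDiff

lemma testToSchwartz_apply {n : ℕ} {U : Opens (Rn n)} (χ : 𝓓(U, ℂ)) (t : Rn n) :
    testToSchwartz χ t = χ t := rfl

/-- `u = S_χ(c) := ∑_{μ ∈ Λ} c_μ T^B_μ χ` in `𝓓'(ℝⁿ)`: the series converges to `u` when tested
against any `φ ∈ 𝓓(ℝⁿ)`, i.e. any Schwartz function `φ` with compact support. -/
def IsSynthesis {n : ℕ} (B : Matrix (Fin n) (Fin n) ℝ) (Λ : Submodule ℤ (Rn n))
    (χ : 𝓢(Rn n, ℂ)) (c : Λ → ℂ) (u : TempDist n) : Prop :=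
  ∀ φ : 𝓢(Rn n, ℂ), HasCompactSupport φ →
    HasSum (fun μ : Λ => c μ * ∫ t, twistedTranslate B (μ : Rn n) χ t * φ t) (u φ)

/-- The discrete space `E^B_d(Λ) = {c ∈ ℂ^Λ | S_χ(c) ∈ E}` for a space `E` embedded in
`𝓢'(ℝⁿ)` by `emb`. -/
def discreteSpace {n : ℕ} {E : Type*} [NormedAddCommGroup E] [NormedSpace ℂ E]
    (emb : E →L[ℂ] TempDist n) (B : Matrix (Fin n) (Fin n) ℝ) (Λ : Submodule ℤ (Rn n))
    (χ : 𝓢(Rn n, ℂ)) : Set (Λ → ℂ) :=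
  {c | ∃ e : E, IsSynthesis B Λ χ c (emb e)}

/-- Cesàro summability to `s` of a family `x` indexed by `Λ = A ℤⁿ`, where the columns of `A`
are the `ℤ`-basis `b` of `Λ`, so that `∑ j, m j • b j` is `A m`: the means
`∑_{|m_j| < N} ∏_j (1 - |m_j| / N) x_{A m}` tend to `s` as `N → ∞`. -/
def HasCesaroSum {n : ℕ} {Λ : Submodule ℤ (Rn n)} (b : Module.Basis (Fin n) ℤ Λ)
    {X : Type*} [AddCommGroup X] [Module ℂ X] [TopologicalSpace X] (x : Λ → X) (s : X) : Prop :=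
  Tendsto (fun N : ℕ =>
      ∑ m ∈ Fintype.piFinset (fun _ : Fin n => Finset.Ioo (-(N : ℤ)) (N : ℤ)),
        ((∏ j, (1 - |(m j : ℝ)| / (N : ℝ)) : ℝ) : ℂ) • x (∑ j, m j • b j))
    atTop (𝓝 s)

end GaborTMIB

end

/-!
Let `η` be a smooth function that is `1` where `χ` does not vanish and `0` off `U`. As the
translates `λ + U` are disjoint, the Cesàro means of `S_χ(c)` are the products `G_N · S_χ(c)` with
the cut-offs `G_N(t) = ∑_m ∏_j (1 - |m_j| / N) η(t - A m)` (`cesaroCutoff`,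
`IsSynthesis.apply_cesaroCutoff`). So everything comes down to the behaviour of multiplication
by `G_N` on a TMIB `E`.

These multiplications are bounded on `E` uniformly in `N`
(`TMIB.exists_norm_incl_cesaroCutoff_le`). Indeed `G_N` has the Fourier transform
`η̂(ξ) ∏_j F_N(b_j · ξ)` with `F_N` the Fejér kernel, so that `G_N f` is the average of the
modulations `M_ξ f` with this weight, and its norm is at most
`C ‖f‖ ∫ (1 + |ξ|)^τ |η̂(ξ)| ∏_j |F_N(b_j · ξ)| dξ` (`TMIB.exists_norm_incl_smulLeftCLM_le`). Since
`F_N ≥ 0` is periodic with mean at most one and `η̂` decays rapidly, the integral is bounded in `N`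
(`exists_integral_cesaroSymbol_le`).

On a compactly supported `φ` only finitely many terms of `G_N φ` are non-zero, so `G_N φ` converges;
such functions are dense in `E`, hence the extended operators `K_N` converge strongly on `E`
(`TMIB.exists_cesaro_operators`). Finally, tested against a compactly supported function, the series
`S_χ(c)` converges absolutely, so its Cesàro means converge to `S_χ(c)` in this weak sense
(`IsSynthesis.tendsto_cesaroCutoff`). This identifies the limit of `K_N e` as `e` in a TMIB, and, for
a functional `e'` in a DTMIB, the weak-* limit of the functionals `e' ∘ K_N` as `e'`.
-/

noncomputable section

namespace GaborTMIB

open scoped FourierTransform Manifold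

/-! ### Strong continuity of translations and modulations on the Schwartz space -/

lemma tendsto_translate_zero {n : ℕ} (φ : 𝓢(Rn n, ℂ)) :
    Tendsto (fun x : Rn n => translate x φ) (𝓝 0) (𝓝 φ) := by
  rw [(schwartz_withSeminorms ℂ (Rn n) ℂ).tendsto_nhds]
  rintro ⟨k, m⟩ ε hε
  set M : ℝ := 2 ^ k * (Finset.Iic (k, m + 1)).sup
    (fun p : ℕ × ℕ => SchwartzMap.seminorm ℂ p.1 p.2) φ with hM
  have hM0 : 0 ≤ M := by positivity
  -- mean value inequality along the segment from `t` to `t - x`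
  have key : ∀ x : Rn n, ‖x‖ ≤ 1 → SchwartzMap.seminorm ℂ k m (translate x φ - φ) ≤ M * ‖x‖ := by
    intro x hx
    refine SchwartzMap.seminorm_le_bound ℂ k m _ (by positivity) fun t => ?_
    have hd : iteratedFDeriv ℝ m (⇑(translate x φ - φ)) t
        = iteratedFDeriv ℝ m φ (t - x) - iteratedFDeriv ℝ m φ t := by
      have h1 : (⇑(translate x φ - φ) : Rn n → ℂ) = (fun s => φ (s - x)) - ⇑φ := by
        ext s; simp [translate_apply]
      have h2 : ContDiff ℝ m (fun s => φ (s - x)) :=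
        (φ.smooth m).comp (contDiff_id.sub contDiff_const)
      rw [h1, iteratedFDeriv_sub h2 (φ.smooth m), iteratedFDeriv_comp_sub' m x]
      rfl
    rw [hd]
    have hdiff : Differentiable ℝ (iteratedFDeriv ℝ m φ) :=
      (φ.smooth ⊤).differentiable_iteratedFDeriv (by exact_mod_cast WithTop.coe_lt_top m)
    have hmv := (convex_segment t (t - x)).norm_image_sub_le_of_norm_fderiv_le
      (𝕜 := ℝ) (f := fun s => (‖t‖ ^ k) • iteratedFDeriv ℝ m φ s) (C := M)
      (fun s _ => (hdiff s).fun_const_smul _) (fun s hs => ?_)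
      (left_mem_segment ℝ _ _) (right_mem_segment ℝ _ _)
    · rw [← smul_sub, norm_smul, Real.norm_of_nonneg (by positivity)] at hmv
      simpa using hmv
    · have hts : ‖t‖ ≤ 1 + ‖s‖ := by
        have h3 : ‖t - s‖ ≤ ‖t - (t - x)‖ := by
          rw [← dist_eq_norm, ← dist_eq_norm, dist_comm, dist_comm t]
          have := dist_add_dist_of_mem_segment hs
          have h4 := dist_nonneg (x := s) (y := t - x)
          rw [dist_comm s t, dist_comm (t - x) t]
          linarith
        have h4 : ‖t‖ ≤ ‖t - s‖ + ‖s‖ := by simpa using norm_add_le (t - s) s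
        have h5 : ‖t - (t - x)‖ = ‖x‖ := by simp
        linarith
      rw [fderiv_fun_const_smul (hdiff s), norm_smul, norm_fderiv_iteratedFDeriv,
        Real.norm_of_nonneg (by positivity)]
      refine le_trans ?_ (SchwartzMap.one_add_le_sup_seminorm_apply (𝕜 := ℂ) (m := (k, m + 1))
        le_rfl le_rfl φ s)
      gcongr
  have hlim : Tendsto (fun x : Rn n => M * ‖x‖) (𝓝 0) (𝓝 0) := by
    have : Continuous fun x : Rn n => M * ‖x‖ := by fun_prop
    simpa using this.tendsto 0
  filter_upwards [hlim.eventually (gt_mem_nhds hε), Metric.closedBall_mem_nhds (0 : Rn n) one_pos]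
    with x h1 h2
  exact (key x (by simpa using h2)).trans_lt h1

/-- Translations act strongly continuously on the Schwartz space. -/
lemma continuous_translate {n : ℕ} (φ : 𝓢(Rn n, ℂ)) :
    Continuous fun x : Rn n => translate x φ := by
  rw [continuous_iff_continuousAt]
  intro y
  have h : (fun x : Rn n => translate x φ) = fun x => translate (x - y) (translate y φ) := by
    ext x t
    simp only [translate_apply]
    congr 1
    abel
  rw [ContinuousAt, h]
  have h0 : Tendsto (fun x : Rn n => x - y) (𝓝 y) (𝓝 0) := by
    have : Continuous fun x : Rn n => x - y := by fun_prop
    simpa using this.tendsto y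
  exact (tendsto_translate_zero _).comp h0

lemma fourier_modulate {n : ℕ} (ξ : Rn n) (φ : 𝓢(Rn n, ℂ)) :
    𝓕 (modulate ξ φ) = translate ξ (𝓕 φ) := by
  ext w
  rw [translate_apply, SchwartzMap.fourier_coe, SchwartzMap.fourier_coe, Real.fourier_eq',
    Real.fourier_eq']
  congr 1
  ext t
  rw [modulate_apply, character, smul_eq_mul, smul_eq_mul, ← mul_assoc, ← Complex.exp_add,
    inner_sub_right]
  congr 2
  push_cast
  ring

/-- Modulations act strongly continuously on the Schwartz space: the Fourier transform turns them
into translations. -/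
lemma continuous_modulate {n : ℕ} (φ : 𝓢(Rn n, ℂ)) :
    Continuous fun ξ : Rn n => modulate ξ φ := by
  have h : (fun ξ : Rn n => modulate ξ φ) = fun ξ => 𝓕⁻ (translate ξ (𝓕 φ)) := by
    ext1 ξ
    rw [← fourier_modulate, FourierTransform.fourierInv_fourier_eq]
  rw [h]
  exact (ContinuousFourierInv.continuous_fourierInv (E := 𝓢(Rn n, ℂ)) (F := 𝓢(Rn n, ℂ))).comp
    (continuous_translate _)

/-! ### Density of compactly supported functions -/

/-- Compactly supported functions are dense in the Schwartz space: `φ` is the limit of the cut-offs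
`t ↦ κ (t / (j + 1)) φ t`, where `κ` is a bump function equal to `1` near `0`. -/
lemma dense_hasCompactSupport (n : ℕ) : Dense {φ : 𝓢(Rn n, ℂ) | HasCompactSupport φ} := by
  intro φ
  let κ : ContDiffBump (0 : Rn n) := ⟨1, 2, one_pos, one_lt_two⟩
  let L : ℕ → (Rn n →L[ℝ] Rn n) := fun j => (1 / ((j : ℝ) + 1)) • ContinuousLinearMap.id ℝ (Rn n)
  have hL : ∀ j t, L j t = (1 / ((j : ℝ) + 1)) • t := fun j t => rfl
  have hκc : ContDiff ℝ ∞ (fun t : Rn n => ((1 - κ t : ℝ) : ℂ)) :=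
    Complex.ofRealCLM.contDiff.comp (contDiff_const.sub κ.contDiff)
  have hκ' : ContDiff ℝ ∞ (fun t : Rn n => ((κ t : ℝ) : ℂ)) :=
    Complex.ofRealCLM.contDiff.comp κ.contDiff
  have hcs : HasCompactSupport (fun t : Rn n => ((κ t : ℝ) : ℂ)) :=
    κ.hasCompactSupport.comp_left (g := fun x : ℝ => (x : ℂ)) (by simp)
  have hcsL : ∀ j, HasCompactSupport (fun t : Rn n => ((κ (L j t) : ℝ) : ℂ)) := by
    intro j
    have hu : (1 / ((j : ℝ) + 1)) ≠ 0 := by positivity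
    exact hcs.comp_homeomorph (Homeomorph.smulOfNeZero _ hu)
  have hcd : ∀ j, ContDiff ℝ ∞ (fun t : Rn n => ((κ (L j t) : ℝ) : ℂ)) :=
    fun j => hκ'.comp (L j).contDiff
  let g : ℕ → 𝓢(Rn n, ℂ) := fun j => ((hcsL j).mul_right (f' := φ)).toSchwartzMap
    ((hcd j).mul (φ.smooth ⊤))
  have hg : ∀ j t, g j t = ((κ (L j t) : ℝ) : ℂ) * φ t := fun j t => rfl
  refine mem_closure_of_tendsto (f := g) (b := atTop) ?_
    (Eventually.of_forall fun j => (hcsL j).mul_right (f' := φ))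
  have hbd : ∀ i : ℕ, ∃ C : ℝ, ∀ t,
      ‖iteratedFDeriv ℝ i (fun t : Rn n => ((1 - κ t : ℝ) : ℂ)) t‖ ≤ C := by
    intro i
    obtain ⟨C, hC⟩ := (hcs.iteratedFDeriv (𝕜 := ℝ) i).exists_bound_of_continuous
      (hκ'.continuous_iteratedFDeriv (by exact_mod_cast le_top))
    refine ⟨1 + C, fun t => ?_⟩
    have h1 : (fun t : Rn n => ((1 - κ t : ℝ) : ℂ))
        = (fun _ => (1 : ℂ)) - fun t => ((κ t : ℝ) : ℂ) := by
      ext t; simp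
    rw [h1, iteratedFDeriv_sub contDiff_const (hκ'.of_le (by exact_mod_cast le_top))]
    refine (norm_sub_le _ _).trans (add_le_add ?_ (hC t))
    rcases Nat.eq_zero_or_pos i with rfl | hi
    · simp
    · rw [iteratedFDeriv_const_of_ne hi.ne']; simp
  choose C hC using hbd
  have hC0 : ∀ i, 0 ≤ C i := fun i => (norm_nonneg _).trans (hC i 0)
  rw [(schwartz_withSeminorms ℂ (Rn n) ℂ).tendsto_nhds]
  rintro ⟨k, m⟩ ε hε
  set M : ℝ := ∑ i ∈ Finset.range (m + 1), (m.choose i : ℝ) * C i *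
    SchwartzMap.seminorm ℂ (k + 1) (m - i) φ with hM
  have hM0 : 0 ≤ M := Finset.sum_nonneg fun i _ => by have := hC0 i; positivity
  -- `1 - κ (t / (j + 1))` vanishes for `‖t‖ < j + 1` and has derivatives bounded independently of
  -- `j`, so one extra power of `‖t‖` gains the factor `1 / (j + 1)`
  have key : ∀ j : ℕ, SchwartzMap.seminorm ℂ k m (g j - φ) ≤ M * (1 / ((j : ℝ) + 1)) := by
    intro j
    rw [← map_neg_eq_map, neg_sub]
    refine SchwartzMap.seminorm_le_bound ℂ k m _ (by positivity) fun t => ?_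
    have h1 : (⇑(φ - g j) : Rn n → ℂ) = fun s => ((1 - κ (L j s) : ℝ) : ℂ) * φ s := by
      ext s; simp [hg]; ring
    rw [h1]
    by_cases ht : ‖t‖ < j + 1
    · have h2 : (fun s => ((1 - κ (L j s) : ℝ) : ℂ) * φ s) =ᶠ[𝓝 t] fun _ => 0 := by
        filter_upwards [(continuous_norm.tendsto t).eventually (gt_mem_nhds ht)] with s hs
        have h3 : κ (L j s) = 1 := by
          refine κ.one_of_mem_closedBall ?_
          rw [mem_closedBall_zero_iff, hL, norm_smul, Real.norm_of_nonneg (by positivity)]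
          change _ ≤ (1 : ℝ)
          rw [one_div, inv_mul_le_one₀ (by positivity)]
          exact hs.le
        simp [h3]
      rw [(Filter.EventuallyEq.iteratedFDeriv ℝ h2 m).eq_of_nhds]
      have h4 : iteratedFDeriv ℝ m (fun _ : Rn n => (0 : ℂ)) t = 0 := by
        change iteratedFDeriv ℝ m (0 : Rn n → ℂ) t = 0
        simp
      rw [h4]
      simp only [norm_zero, mul_zero]
      positivity
    · push Not at ht
      have h2 := norm_iteratedFDeriv_mul_le (𝕜 := ℝ) (N := ∞)
        (f := fun s => ((1 - κ (L j s) : ℝ) : ℂ)) (g := φ)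
        (hκc.comp (L j).contDiff) (φ.smooth ⊤) t (n := m) (by exact_mod_cast le_top)
      have h5 : ∀ i, ‖iteratedFDeriv ℝ i (fun s => ((1 - κ (L j s) : ℝ) : ℂ)) t‖ ≤ C i := by
        intro i
        have h6 := (L j).iteratedFDeriv_comp_right hκc t (i := i) (by exact_mod_cast le_top)
        rw [Function.comp_def] at h6
        rw [h6]
        refine (ContinuousMultilinearMap.norm_compContinuousLinearMap_le _ _).trans ?_
        refine (mul_le_of_le_one_right (norm_nonneg _) ?_).trans (hC i _)
        refine Finset.prod_le_one (fun _ _ => norm_nonneg _) fun _ _ => ?_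
        refine ContinuousLinearMap.opNorm_le_bound _ zero_le_one fun s => ?_
        rw [hL, norm_smul, Real.norm_of_nonneg (by positivity)]
        gcongr
        rw [div_le_one (by positivity)]
        linarith [(Nat.cast_nonneg j : (0 : ℝ) ≤ j)]
      have hj : ‖t‖ ^ k ≤ ‖t‖ ^ (k + 1) * (1 / ((j : ℝ) + 1)) := by
        rw [pow_succ, mul_assoc]
        refine le_mul_of_one_le_right (by positivity) ?_
        rw [mul_one_div, le_div_iff₀ (by positivity)]
        linarith
      calc _ ≤ ‖t‖ ^ k * ∑ i ∈ Finset.range (m + 1), (m.choose i : ℝ) *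
            ‖iteratedFDeriv ℝ i (fun s => ((1 - κ (L j s) : ℝ) : ℂ)) t‖ *
            ‖iteratedFDeriv ℝ (m - i) φ t‖ := by gcongr
        _ ≤ (‖t‖ ^ (k + 1) * (1 / ((j : ℝ) + 1))) * ∑ i ∈ Finset.range (m + 1), (m.choose i : ℝ) *
            C i * ‖iteratedFDeriv ℝ (m - i) φ t‖ := by
          gcongr
          · exact h5 _
        _ = (∑ i ∈ Finset.range (m + 1), (m.choose i : ℝ) *
            C i * (‖t‖ ^ (k + 1) * ‖iteratedFDeriv ℝ (m - i) φ t‖)) * (1 / ((j : ℝ) + 1)) := by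
          rw [mul_assoc, mul_comm (1 / _), ← mul_assoc, Finset.mul_sum]
          congr 2
          ext i; ring
        _ ≤ _ := by
          rw [hM]
          gcongr with i
          · have := hC0 i; positivity
          · exact SchwartzMap.le_seminorm ℂ (k + 1) (m - i) φ t
  have hlim : Tendsto (fun j : ℕ => M * (1 / ((j : ℝ) + 1))) atTop (𝓝 0) := by
    simpa using tendsto_one_div_add_atTop_nhds_zero_nat.const_mul M
  filter_upwards [hlim.eventually (gt_mem_nhds hε)] with j h1
  exact (key j).trans_lt h1

/-! ### Multipliers of a TMIB as averages of modulations -/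

lemma norm_character {n : ℕ} (ξ t : Rn n) : ‖character ξ t‖ = 1 := by
  rw [character, Complex.norm_exp]
  simp

lemma continuous_character_uncurry (n : ℕ) :
    Continuous fun p : Rn n × Rn n => character p.1 p.2 := by
  unfold character
  fun_prop

namespace TMIB

variable {n : ℕ} {E : Type*} [NormedAddCommGroup E] [NormedSpace ℂ E] [CompleteSpace E]

lemma exists_norm_incl_modulate_le (h : TMIB n E) :
    ∃ C : ℝ, 0 ≤ C ∧ ∃ τ : ℕ, ∀ (ξ : Rn n) (φ : 𝓢(Rn n, ℂ)),
      ‖h.incl (modulate ξ φ)‖ ≤ C * (1 + ‖ξ‖) ^ τ * ‖h.incl φ‖ := by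
  obtain ⟨C, hC, τ, -, hb⟩ := h.modulate_bound
  refine ⟨C, hC.le, ⌈τ⌉₊, fun ξ φ => ?_⟩
  have h1 : h.emb (h.incl (modulate ξ φ)) = modulateDist (-(-ξ)) (h.emb (h.incl φ)) := by
    ext ψ
    rw [neg_neg, modulateDist, ContinuousLinearMap.comp_apply, h.emb_incl, h.emb_incl]
    congr 1
    ext t
    rw [modulate_apply, modulate_apply]
    ring
  refine (hb (-ξ) _ _ h1).trans ?_
  rw [norm_neg, ← Real.rpow_natCast]
  gcongr
  · linarith [norm_nonneg ξ]
  · exact Nat.le_ceil τ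

/-- A function `g` whose inverse Fourier representation `g t = ∫ w ξ e^{2πi t·ξ} dξ` has a weight
`w` integrable against a suitable power of `1 + |ξ|` acts on a TMIB as a multiplier, with norm at
most the weighted `L¹` norm of `w`: multiplication by `g` is the average of the modulations with
weight `w`. -/
theorem exists_norm_incl_smulLeftCLM_le (h : TMIB n E) :
    ∃ C : ℝ, 0 ≤ C ∧ ∃ τ : ℕ, ∀ w : Rn n → ℂ, Continuous w →
      Integrable (fun ξ => (1 + ‖ξ‖) ^ τ * ‖w ξ‖) →
      ∀ g : Rn n → ℂ, g.HasTemperateGrowth → (∀ t, g t = ∫ ξ, w ξ * character ξ t) →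
      ∀ φ : 𝓢(Rn n, ℂ), ‖h.incl (SchwartzMap.smulLeftCLM ℂ g φ)‖
        ≤ C * (∫ ξ, (1 + ‖ξ‖) ^ τ * ‖w ξ‖) * ‖h.incl φ‖ := by
  obtain ⟨C, hC, τ, hb⟩ := h.exists_norm_incl_modulate_le
  refine ⟨C, hC, τ, fun w hw hint g hg hgw φ => ?_⟩
  have hcont : Continuous fun ξ => w ξ • h.incl (modulate ξ φ) :=
    hw.smul (h.incl.continuous.comp (continuous_modulate φ))
  have hle : ∀ ξ, ‖w ξ • h.incl (modulate ξ φ)‖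
      ≤ (C * ‖h.incl φ‖) * ((1 + ‖ξ‖) ^ τ * ‖w ξ‖) := by
    intro ξ
    rw [norm_smul]
    calc _ ≤ ‖w ξ‖ * (C * (1 + ‖ξ‖) ^ τ * ‖h.incl φ‖) := by gcongr; exact hb ξ φ
      _ = _ := by ring
  have hintE : Integrable fun ξ => w ξ • h.incl (modulate ξ φ) :=
    (hint.const_mul _).mono' hcont.aestronglyMeasurable (Eventually.of_forall hle)
  have hwint : Integrable w := by
    refine hint.mono' hw.aestronglyMeasurable (Eventually.of_forall fun ξ => ?_)
    refine le_mul_of_one_le_left (norm_nonneg _) (one_le_pow₀ ?_)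
    linarith [norm_nonneg ξ]
  have heq : h.incl (SchwartzMap.smulLeftCLM ℂ g φ) = ∫ ξ, w ξ • h.incl (modulate ξ φ) := by
    refine h.injective_emb ?_
    ext ψ
    have h1 : h.emb (∫ ξ, w ξ • h.incl (modulate ξ φ)) ψ
        = ∫ ξ, h.dualIncl ψ (w ξ • h.incl (modulate ξ φ)) := by
      rw [← h.dualIncl_apply, ContinuousLinearMap.integral_comp_comm _ hintE]
    have hφψ : Integrable fun t => φ t * ψ t := by
      have := (SchwartzMap.smulLeftCLM ℂ (φ : Rn n → ℂ) ψ).integrable (μ := volume)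
      simpa [SchwartzMap.smulLeftCLM_apply φ.hasTemperateGrowth] using this
    have h2 : Integrable (Function.uncurry fun (ξ t : Rn n) => w ξ * character ξ t * (φ t * ψ t))
        (volume.prod volume) := by
      refine ((hwint.mul_prod hφψ).norm).mono' ?_ (Eventually.of_forall fun p => ?_)
      · refine Continuous.aestronglyMeasurable ?_
        have := continuous_character_uncurry n
        have h4 : Continuous φ := φ.continuous
        have h5 : Continuous ψ := ψ.continuous
        simp only [Function.uncurry_def]
        fun_prop
      · simp [Function.uncurry, norm_character]
    rw [h1, h.emb_incl]
    have h3 : ∀ ξ, h.dualIncl ψ (w ξ • h.incl (modulate ξ φ))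
        = ∫ t, w ξ * character ξ t * (φ t * ψ t) := by
      intro ξ
      rw [map_smul, h.dualIncl_apply, h.emb_incl, smul_eq_mul, ← integral_const_mul]
      congr 1
      ext t
      rw [modulate_apply]
      ring
    simp_rw [h3]
    rw [integral_integral_swap h2]
    congr 1
    ext t
    rw [integral_mul_const, ← hgw t, SchwartzMap.smulLeftCLM_apply_apply hg, smul_eq_mul, mul_assoc]
  rw [heq]
  refine (norm_integral_le_of_norm_le (hint.const_mul _) (Eventually.of_forall hle)).trans ?_
  rw [integral_const_mul]
  apply le_of_eq
  ring

end TMIB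

/-! ### The Fejér kernel -/

/-- The coefficient `1 - |k| / N` of the Cesàro means. -/
def cesaroWeight (N : ℕ) (k : ℤ) : ℝ := 1 - |(k : ℝ)| / N

/-- The Fejér kernel `∑_{|k| < N} (1 - |k| / N) e^{-2πi k s}`; it is zero for `N = 0`. -/
def fejerKernel (N : ℕ) (s : ℝ) : ℂ :=
  ∑ k ∈ Finset.Ioo (-(N : ℤ)) N, (cesaroWeight N k : ℂ) *
    Complex.exp (-(2 * Real.pi * Complex.I * (k : ℂ) * s))

lemma sum_Ioo_neg_add_one (f : ℤ → ℂ) (N : ℕ) :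
    ∑ k ∈ Finset.Ioo (-((N : ℤ) + 1)) (N + 1), f k
      = f 0 + ∑ j ∈ Finset.range N, (f (j + 1) + f (-(j + 1))) := by
  induction N with
  | zero =>
    have : Finset.Ioo (-(((0 : ℕ) : ℤ) + 1)) ((0 : ℕ) + 1) = {0} := by
      ext k; simp; omega
    rw [this]; simp
  | succ N ih =>
    have : Finset.Ioo (-(((N + 1 : ℕ) : ℤ) + 1)) ((N + 1 : ℕ) + 1)
        = insert ((N : ℤ) + 1) (insert (-((N : ℤ) + 1)) (Finset.Ioo (-((N : ℤ) + 1)) (N + 1))) := by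
      ext k; simp; omega
    rw [this, Finset.sum_insert (by simp; omega), Finset.sum_insert (by simp), ih,
      Finset.sum_range_succ]
    ring

/-- The differences `j - l` with `0 ≤ j, l < N` take the value `k` exactly `N - |k|` times. -/
lemma sum_sum_range_sub (f : ℤ → ℂ) (N : ℕ) :
    ∑ j ∈ Finset.range N, ∑ l ∈ Finset.range N, f (j - l)
      = ∑ k ∈ Finset.Ioo (-(N : ℤ)) N, ((N : ℂ) - |(k : ℝ)|) * f k := by
  induction N with
  | zero => simp
  | succ N ih =>
    have h1 : ∑ k ∈ Finset.Ioo (-((N : ℤ) + 1)) (N + 1), ((N : ℂ) - |(k : ℝ)|) * f k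
        = ∑ k ∈ Finset.Ioo (-(N : ℤ)) N, ((N : ℂ) - |(k : ℝ)|) * f k := by
      symm
      refine Finset.sum_subset (fun k hk => ?_) fun k hk hk' => ?_
      · simp at hk ⊢; omega
      · simp only [Finset.mem_Ioo, not_and_or, not_lt] at hk hk'
        have h2 : |k| = N := by
          rcases abs_cases k with h | h <;> omega
        have h3 : |(k : ℝ)| = N := by exact_mod_cast h2
        simp [h3]
    have h2 : ∑ k ∈ Finset.Ioo (-((N : ℤ) + 1)) (N + 1), f k
        = f 0 + (∑ j ∈ Finset.range N, f (N - j) + ∑ j ∈ Finset.range N, f (j - N)) := by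
      rw [sum_Ioo_neg_add_one, Finset.sum_add_distrib,
        ← Finset.sum_range_reflect (fun j : ℕ => f ((N : ℤ) - j)),
        ← Finset.sum_range_reflect (fun j : ℕ => f ((j : ℤ) - N))]
      congr 2 <;> refine Finset.sum_congr rfl fun j hj => ?_ <;>
        have := Finset.mem_range.1 hj <;> congr 1 <;> omega
    calc _ = (∑ j ∈ Finset.range N, ∑ l ∈ Finset.range N, f (j - l))
          + (f 0 + (∑ j ∈ Finset.range N, f (N - j) + ∑ j ∈ Finset.range N, f (j - N))) := by
          rw [Finset.sum_range_succ]
          simp_rw [Finset.sum_range_succ]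
          rw [Finset.sum_add_distrib]
          simp
          ring
      _ = _ := by
          rw [ih, ← h1, ← h2, ← Finset.sum_add_distrib]
          push_cast
          refine Finset.sum_congr rfl fun k _ => ?_
          ring

/-- The Fejér kernel is the normalised square of a Dirichlet sum. -/
lemma fejerKernel_eq (N : ℕ) (s : ℝ) :
    fejerKernel N s = ((‖∑ j ∈ Finset.range N,
      Complex.exp (-(2 * Real.pi * Complex.I * (j : ℂ) * s))‖ ^ 2 / N : ℝ) : ℂ) := by
  rcases Nat.eq_zero_or_pos N with rfl | hN
  · simp [fejerKernel]
  have hN' : (N : ℂ) ≠ 0 := by exact_mod_cast hN.ne'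
  rw [Complex.ofReal_div, Complex.ofReal_pow, ← Complex.mul_conj', map_sum, Finset.sum_mul_sum]
  have h := sum_sum_range_sub (fun k => Complex.exp (-(2 * Real.pi * Complex.I * (k : ℂ) * s))) N
  have h2 : ∀ j l : ℕ, Complex.exp (-(2 * Real.pi * Complex.I * (j : ℂ) * s)) *
      (starRingEnd ℂ) (Complex.exp (-(2 * Real.pi * Complex.I * (l : ℂ) * s)))
      = Complex.exp (-(2 * Real.pi * Complex.I * (((j : ℤ) - (l : ℤ) : ℤ) : ℂ) * s)) := by
    intro j l
    rw [← Complex.exp_conj, ← Complex.exp_add]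
    congr 1
    have h3 : (starRingEnd ℂ) 2 = 2 := map_ofNat _ 2
    simp [h3]
    ring
  simp_rw [h2]
  rw [h, fejerKernel, Complex.ofReal_natCast, Finset.sum_div]
  refine Finset.sum_congr rfl fun k _ => ?_
  rw [cesaroWeight]
  push_cast
  field_simp

lemma fejerKernel_eq_norm (N : ℕ) (s : ℝ) : fejerKernel N s = (‖fejerKernel N s‖ : ℂ) := by
  have h : (0 : ℝ) ≤ ‖∑ j ∈ Finset.range N,
      Complex.exp (-(2 * Real.pi * Complex.I * (j : ℂ) * s))‖ ^ 2 / N := by positivity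
  rw [fejerKernel_eq, Complex.norm_real, Real.norm_of_nonneg h]

lemma continuous_fejerKernel (N : ℕ) : Continuous (fejerKernel N) := by
  unfold fejerKernel
  fun_prop

lemma fejerKernel_add_int (N : ℕ) (s : ℝ) (m : ℤ) : fejerKernel N (s + m) = fejerKernel N s := by
  unfold fejerKernel
  refine Finset.sum_congr rfl fun k _ => ?_
  congr 1
  rw [Complex.exp_eq_exp_iff_exists_int]
  refine ⟨-(k * m), ?_⟩
  push_cast
  ring

lemma norm_fejerKernel_le (N : ℕ) (s : ℝ) :
    ‖fejerKernel N s‖ ≤ ∑ k ∈ Finset.Ioo (-(N : ℤ)) N, ‖(cesaroWeight N k : ℂ)‖ := by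
  refine (norm_sum_le _ _).trans (Finset.sum_le_sum fun k _ => ?_)
  rw [norm_mul, Complex.norm_exp]
  simp

lemma integral_norm_fejerKernel_le (N : ℕ) : ∫ s in (0 : ℝ)..1, ‖fejerKernel N s‖ ≤ 1 := by
  have h1 : ∫ s in (0 : ℝ)..1, fejerKernel N s
      = ((∫ s in (0 : ℝ)..1, ‖fejerKernel N s‖ : ℝ) : ℂ) := by
    rw [← intervalIntegral.integral_ofReal]
    refine intervalIntegral.integral_congr fun s _ => fejerKernel_eq_norm N s
  have h2 : ∫ s in (0 : ℝ)..1, fejerKernel N s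
      = ∑ k ∈ Finset.Ioo (-(N : ℤ)) N, if k = 0 then (1 : ℂ) else 0 := by
    unfold fejerKernel
    rw [intervalIntegral.integral_finsetSum
      (fun k _ => Continuous.intervalIntegrable (by fun_prop) _ _)]
    refine Finset.sum_congr rfl fun k _ => ?_
    rw [intervalIntegral.integral_const_mul]
    split_ifs with hk
    · simp [hk, cesaroWeight]
    · have hc : (-(2 * Real.pi * Complex.I * (k : ℂ))) ≠ 0 := by
        have : (k : ℂ) ≠ 0 := by exact_mod_cast hk
        simp [this, Real.pi_ne_zero, Complex.I_ne_zero]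
      have h3 : ∀ s : ℝ, -(2 * Real.pi * Complex.I * (k : ℂ) * s)
          = (-(2 * Real.pi * Complex.I * (k : ℂ))) * s := fun s => by ring
      simp_rw [h3]
      rw [integral_exp_mul_complex hc]
      have h4 : Complex.exp (-(2 * Real.pi * Complex.I * (k : ℂ)) * (1 : ℝ)) = 1 := by
        rw [Complex.exp_eq_one_iff]
        refine ⟨-k, ?_⟩
        push_cast
        ring
      rw [h4]
      simp
  have h3 : (∫ s in (0 : ℝ)..1, ‖fejerKernel N s‖)
      = ∑ k ∈ Finset.Ioo (-(N : ℤ)) N, if k = 0 then (1 : ℝ) else 0 := by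
    refine Complex.ofReal_injective ?_
    rw [← h1, h2, Complex.ofReal_sum]
    refine Finset.sum_congr rfl fun k _ => ?_
    split_ifs <;> simp
  rw [h3, Finset.sum_ite_eq']
  split_ifs <;> simp

lemma integrable_fejerKernel_mul (N : ℕ) :
    Integrable fun s : ℝ => ‖fejerKernel N s‖ * (1 + s ^ 2)⁻¹ := by
  refine integrable_inv_one_add_sq.bdd_mul (c := ∑ k ∈ Finset.Ioo (-(N : ℤ)) N,
    ‖(cesaroWeight N k : ℂ)‖) (continuous_fejerKernel N).norm.aestronglyMeasurable
    (Eventually.of_forall fun s => ?_)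
  rw [norm_norm]
  exact norm_fejerKernel_le N s

/-- The Fejér kernels are uniformly integrable against `1 / (1 + s²)`: over a period the weight
varies by a bounded factor, and the kernel has mass at most one. -/
lemma integral_fejerKernel_mul_le (N : ℕ) :
    ∫ s : ℝ, ‖fejerKernel N s‖ * (1 + s ^ 2)⁻¹ ≤ 9 * Real.pi := by
  have h1 := (integrable_fejerKernel_mul N).hasSum_intervalIntegral_comp_add_int
  have h2 := (integrable_inv_one_add_sq.const_mul 9).hasSum_intervalIntegral_comp_add_int
  have h3 : ∫ s : ℝ, 9 * (1 + s ^ 2)⁻¹ = 9 * Real.pi := by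
    rw [integral_const_mul, integral_univ_inv_one_add_sq]
  rw [← h3]
  refine hasSum_le (fun m => ?_) h1 h2
  have hcomp : ∀ x ∈ Set.Icc (0 : ℝ) 1, (1 + (x + m) ^ 2)⁻¹ ≤ 3 * (1 + (m : ℝ) ^ 2)⁻¹ ∧
      3 * (1 + (m : ℝ) ^ 2)⁻¹ ≤ 9 * (1 + (x + m) ^ 2)⁻¹ := by
    rintro x ⟨hx0, hx1⟩
    have hx2 : x ^ 2 ≤ 1 := by nlinarith
    rw [← div_eq_mul_inv, ← div_eq_mul_inv, ← one_div,
      div_le_div_iff₀ (by positivity) (by positivity),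
      div_le_div_iff₀ (by positivity) (by positivity)]
    constructor
    · nlinarith [sq_nonneg (2 * x + m), sq_nonneg ((m : ℝ) + x + x)]
    · nlinarith [sq_nonneg (x - m)]
  have hc1 : Continuous fun x : ℝ => ‖fejerKernel N (x + m)‖ * (1 + (x + m) ^ 2)⁻¹ := by
    refine ((continuous_fejerKernel N).comp (by fun_prop)).norm.mul (Continuous.inv₀ (by fun_prop) ?_)
    intro x; positivity
  have hc2 : Continuous fun x : ℝ => 9 * (1 + (x + m) ^ 2)⁻¹ := by
    refine continuous_const.mul (Continuous.inv₀ (by fun_prop) ?_)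
    intro x; positivity
  calc ∫ x in (0 : ℝ)..1, ‖fejerKernel N (x + m)‖ * (1 + (x + m) ^ 2)⁻¹
      ≤ ∫ x in (0 : ℝ)..1, ‖fejerKernel N x‖ * (3 * (1 + (m : ℝ) ^ 2)⁻¹) := by
        refine intervalIntegral.integral_mono_on zero_le_one (hc1.intervalIntegrable _ _)
          (((continuous_fejerKernel N).norm.mul continuous_const).intervalIntegrable _ _)
          fun x hx => ?_
        rw [fejerKernel_add_int]
        exact mul_le_mul_of_nonneg_left (hcomp x hx).1 (norm_nonneg _)
    _ ≤ 3 * (1 + (m : ℝ) ^ 2)⁻¹ := by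
        rw [intervalIntegral.integral_mul_const]
        exact mul_le_of_le_one_left (by positivity) (integral_norm_fejerKernel_le N)
    _ = ∫ x in (0 : ℝ)..1, 3 * (1 + (m : ℝ) ^ 2)⁻¹ := by simp
    _ ≤ _ := by
        refine intervalIntegral.integral_mono_on zero_le_one (by simp)
          (hc2.intervalIntegrable _ _) fun x hx => (hcomp x hx).2

variable {n : ℕ}

/-! ### The Cesàro cut-offs and their Fourier transforms -/

/-- Integration in the coordinates `ξ ↦ (v j · ξ)_j` given by a basis `v` of `ℝⁿ`. -/
lemma exists_integral_comp_inner (v : Module.Basis (Fin n) ℝ (Rn n)) :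
    ∃ c : ℝ, 0 ≤ c ∧ ∀ F : (Fin n → ℝ) → ℝ, Integrable F →
      Integrable (fun ξ : Rn n => F fun j => inner ℝ (v j) ξ) ∧
      ∫ ξ : Rn n, F (fun j => inner ℝ (v j) ξ) = c * ∫ y, F y := by
  let L₀ : Rn n →ₗ[ℝ] (Fin n → ℝ) := LinearMap.pi fun j => (innerₛₗ ℝ (v j))
  have hL₀ : ∀ ξ j, L₀ ξ j = inner ℝ (v j) ξ := fun ξ j => rfl
  have hinj : Function.Injective L₀ := by
    rw [← LinearMap.ker_eq_bot, LinearMap.ker_eq_bot']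
    intro ξ hξ
    have h1 : innerₛₗ ℝ ξ = 0 := v.ext fun j => by
      have h2 := congrFun hξ j
      rw [hL₀, real_inner_comm] at h2
      exact h2
    have h3 : inner ℝ ξ ξ = (0 : ℝ) := LinearMap.congr_fun h1 ξ
    exact inner_self_eq_zero.1 h3
  let L : Rn n ≃L[ℝ] (Fin n → ℝ) :=
    (LinearEquiv.ofInjectiveOfFinrankEq L₀ hinj (by simp)).toContinuousLinearEquiv
  have : (Measure.map L (volume : Measure (Rn n))).IsAddHaarMeasure :=
    L.isAddHaarMeasure_map _
  have hmap := Measure.isAddLeftInvariant_eq_smul (Measure.map L (volume : Measure (Rn n))) volume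
  set κ := Measure.addHaarScalarFactor (Measure.map L (volume : Measure (Rn n))) volume
  refine ⟨κ, κ.2, fun F hF => ?_⟩
  have hemb : MeasurableEmbedding L := L.toHomeomorph.measurableEmbedding
  constructor
  · have h1 : Integrable F (Measure.map L (volume : Measure (Rn n))) := by
      rw [hmap]
      exact hF.smul_measure_nnreal
    exact hemb.integrable_map_iff.1 h1
  · have h2 := hemb.integral_map (μ := volume) F
    rw [hmap, integral_smul_nnreal_measure] at h2
    exact h2.symm

/-- The function `∑_{|m_j| < N} ∏_j (1 - |m_j| / N) η(t - ∑_j m_j v_j)`. -/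
def cesaroCutoff (v : Fin n → Rn n) (η : 𝓢(Rn n, ℂ)) (N : ℕ) : 𝓢(Rn n, ℂ) :=
  ∑ m ∈ Fintype.piFinset (fun _ : Fin n => Finset.Ioo (-(N : ℤ)) (N : ℤ)),
    ((∏ j, cesaroWeight N (m j) : ℝ) : ℂ) • translate (∑ j, m j • v j) η

/-- The Fourier transform of `cesaroCutoff`: that of `η` times a product of Fejér kernels. -/
def cesaroSymbol (v : Fin n → Rn n) (η : 𝓢(Rn n, ℂ)) (N : ℕ) (ξ : Rn n) : ℂ :=
  𝓕 η ξ * ∏ j, fejerKernel N (inner ℝ (v j) ξ)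

lemma cesaroCutoff_apply (v : Fin n → Rn n) (η : 𝓢(Rn n, ℂ)) (N : ℕ) (t : Rn n) :
    cesaroCutoff v η N t = ∑ m ∈ Fintype.piFinset (fun _ : Fin n => Finset.Ioo (-(N : ℤ)) (N : ℤ)),
      ((∏ j, cesaroWeight N (m j) : ℝ) : ℂ) * η (t - ∑ j, m j • v j) := by
  simp [cesaroCutoff, translate_apply]

lemma continuous_cesaroSymbol (v : Fin n → Rn n) (η : 𝓢(Rn n, ℂ)) (N : ℕ) :
    Continuous (cesaroSymbol v η N) := by
  refine (𝓕 η).continuous.mul (continuous_finsetProd _ fun j _ => ?_)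
  exact (continuous_fejerKernel N).comp (by fun_prop)

lemma prod_fejerKernel (v : Fin n → Rn n) (N : ℕ) (ξ : Rn n) :
    ∏ j, fejerKernel N (inner ℝ (v j) ξ)
      = ∑ m ∈ Fintype.piFinset (fun _ : Fin n => Finset.Ioo (-(N : ℤ)) (N : ℤ)),
        ((∏ j, cesaroWeight N (m j) : ℝ) : ℂ) * character ξ (-∑ j, m j • v j) := by
  unfold fejerKernel
  rw [Finset.prod_univ_sum]
  refine Finset.sum_congr rfl fun m _ => ?_
  rw [Finset.prod_mul_distrib, ← Complex.exp_sum, Complex.ofReal_prod, character]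
  congr 2
  rw [inner_neg_left, sum_inner]
  push_cast
  rw [mul_neg, Finset.mul_sum, ← Finset.sum_neg_distrib]
  refine Finset.sum_congr rfl fun j _ => ?_
  rw [← Int.cast_smul_eq_zsmul ℝ, real_inner_smul_left]
  push_cast
  ring

lemma character_add_right (ξ s t : Rn n) :
    character ξ (s + t) = character ξ s * character ξ t := by
  simp only [character]
  rw [← Complex.exp_add, inner_add_left]
  congr 1
  push_cast
  ring

lemma fourierInv_integral (η : 𝓢(Rn n, ℂ)) (t : Rn n) :
    η t = ∫ ξ, 𝓕 η ξ * character ξ t := by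
  conv_lhs => rw [← FourierTransform.fourierInv_fourier_eq (E := 𝓢(Rn n, ℂ)) (F := 𝓢(Rn n, ℂ)) η]
  rw [SchwartzMap.fourierInv_coe, Real.fourierInv_eq']
  congr 1
  ext ξ
  rw [smul_eq_mul, mul_comm, character, real_inner_comm]
  congr 2
  push_cast
  ring

lemma integrable_fourier_mul_character (η : 𝓢(Rn n, ℂ)) (t : Rn n) :
    Integrable fun ξ => 𝓕 η ξ * character ξ t := by
  refine ((𝓕 η).integrable (μ := volume)).mul_bdd (c := 1) ?_
    (Eventually.of_forall fun ξ => (norm_character ξ t).le)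
  exact ((continuous_character_uncurry n).comp (by fun_prop : Continuous fun ξ : Rn n => (ξ, t)))
    |>.aestronglyMeasurable

lemma cesaroCutoff_eq_integral (v : Fin n → Rn n) (η : 𝓢(Rn n, ℂ)) (N : ℕ) (t : Rn n) :
    cesaroCutoff v η N t = ∫ ξ, cesaroSymbol v η N ξ * character ξ t := by
  have h : ∀ ξ, cesaroSymbol v η N ξ * character ξ t
      = ∑ m ∈ Fintype.piFinset (fun _ : Fin n => Finset.Ioo (-(N : ℤ)) (N : ℤ)),
        ((∏ j, cesaroWeight N (m j) : ℝ) : ℂ) *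
          (𝓕 η ξ * character ξ (t - ∑ j, m j • v j)) := by
    intro ξ
    rw [cesaroSymbol, prod_fejerKernel, Finset.mul_sum, Finset.sum_mul]
    refine Finset.sum_congr rfl fun m _ => ?_
    rw [sub_eq_add_neg, character_add_right]
    ring
  simp_rw [h]
  rw [integral_finsetSum _ fun m _ => (integrable_fourier_mul_character η _).const_mul _,
    cesaroCutoff_apply]
  refine Finset.sum_congr rfl fun m _ => ?_
  rw [integral_const_mul, ← fourierInv_integral]

/-- The weight `∏_j (1 + (v_j · ξ)²)⁻¹` matches the product structure of the Fejér kernels in the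
coordinates `v_j · ξ`. -/
lemma exists_fourier_decay (v : Fin n → Rn n) (η : 𝓢(Rn n, ℂ)) (τ : ℕ) :
    ∃ C : ℝ, 0 ≤ C ∧ ∀ ξ, (1 + ‖ξ‖) ^ τ * ‖𝓕 η ξ‖ ≤ C * ∏ j, (1 + (inner ℝ (v j) ξ) ^ 2)⁻¹ := by
  set V : ℝ := ∏ j, (1 + ‖v j‖ ^ 2)
  have hV : 0 ≤ V := Finset.prod_nonneg fun j _ => by positivity
  set M : ℝ := 2 ^ (τ + 2 * n) * (Finset.Iic (τ + 2 * n, 0)).sup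
    (fun p : ℕ × ℕ => SchwartzMap.seminorm ℂ p.1 p.2) (𝓕 η)
  have hM : 0 ≤ M := by positivity
  refine ⟨V * M, by positivity, fun ξ => ?_⟩
  have h1 : (1 + ‖ξ‖) ^ (τ + 2 * n) * ‖𝓕 η ξ‖ ≤ M := by
    have := SchwartzMap.one_add_le_sup_seminorm_apply (𝕜 := ℂ) (m := (τ + 2 * n, 0)) le_rfl le_rfl
      (𝓕 η) ξ
    rwa [norm_iteratedFDeriv_zero] at this
  have h2 : ∏ j, (1 + (inner ℝ (v j) ξ) ^ 2) ≤ V * (1 + ‖ξ‖) ^ (2 * n) := by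
    have h3 : ∏ _j : Fin n, (1 + ‖ξ‖) ^ 2 = (1 + ‖ξ‖) ^ (2 * n) := by
      rw [Finset.prod_const, ← pow_mul]; simp
    rw [← h3, ← Finset.prod_mul_distrib]
    refine Finset.prod_le_prod (fun j _ => by positivity) fun j _ => ?_
    have h4 : (inner ℝ (v j) ξ : ℝ) ^ 2 ≤ (‖v j‖ * ‖ξ‖) ^ 2 := by
      rw [← sq_abs]
      gcongr
      exact abs_real_inner_le_norm _ _
    nlinarith [norm_nonneg ξ, norm_nonneg (v j), mul_nonneg (sq_nonneg ‖v j‖) (norm_nonneg ξ)]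
  have hpos : 0 < ∏ j, (1 + (inner ℝ (v j) ξ : ℝ) ^ 2) := Finset.prod_pos fun j _ => by positivity
  rw [Finset.prod_inv_distrib, ← div_eq_mul_inv, le_div_iff₀ hpos]
  calc _ ≤ (1 + ‖ξ‖) ^ τ * ‖𝓕 η ξ‖ * (V * (1 + ‖ξ‖) ^ (2 * n)) := by gcongr
    _ = V * ((1 + ‖ξ‖) ^ (τ + 2 * n) * ‖𝓕 η ξ‖) := by rw [pow_add]; ring
    _ ≤ _ := by gcongr

/-- The weighted `L¹` norms of the symbols of the Cesàro cut-offs are bounded independently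
of `N`. -/
theorem exists_integral_cesaroSymbol_le (v : Module.Basis (Fin n) ℝ (Rn n)) (η : 𝓢(Rn n, ℂ))
    (τ : ℕ) : ∃ C : ℝ, 0 ≤ C ∧ ∀ N : ℕ,
      Integrable (fun ξ => (1 + ‖ξ‖) ^ τ * ‖cesaroSymbol v η N ξ‖) ∧
      ∫ ξ, (1 + ‖ξ‖) ^ τ * ‖cesaroSymbol v η N ξ‖ ≤ C := by
  obtain ⟨D, hD, hdec⟩ := exists_fourier_decay v η τ
  obtain ⟨c, hc, hint⟩ := exists_integral_comp_inner v
  refine ⟨D * (c * (9 * Real.pi) ^ n), by positivity, fun N => ?_⟩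
  set F : (Fin n → ℝ) → ℝ := fun y => ∏ j, (‖fejerKernel N (y j)‖ * (1 + y j ^ 2)⁻¹) with hF
  have hFint : Integrable F := by
    exact Integrable.fintype_prod (fun _ => integrable_fejerKernel_mul N)
  have hFle : ∫ y, F y ≤ (9 * Real.pi) ^ n := by
    rw [hF, integral_fintype_prod_volume_eq_pow
      (fun s : ℝ => ‖fejerKernel N s‖ * (1 + s ^ 2)⁻¹), Fintype.card_fin]
    exact pow_le_pow_left₀ (integral_nonneg fun s => by positivity)
      (integral_fejerKernel_mul_le N) n
  obtain ⟨hi, he⟩ := hint F hFint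
  have hle : ∀ ξ, (1 + ‖ξ‖) ^ τ * ‖cesaroSymbol v η N ξ‖
      ≤ D * F fun j => inner ℝ (v j) ξ := by
    intro ξ
    rw [cesaroSymbol, norm_mul, norm_prod, ← mul_assoc, hF]
    calc _ ≤ (D * ∏ j, (1 + (inner ℝ (v j) ξ : ℝ) ^ 2)⁻¹) *
          ∏ j, ‖fejerKernel N (inner ℝ (v j) ξ)‖ := by
          exact mul_le_mul_of_nonneg_right (hdec ξ) (Finset.prod_nonneg fun _ _ => norm_nonneg _)
      _ = _ := by
          simp only [Finset.prod_mul_distrib]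
          ring
  have hcont : Continuous fun ξ => (1 + ‖ξ‖) ^ τ * ‖cesaroSymbol v η N ξ‖ :=
    (by fun_prop : Continuous fun ξ : Rn n => (1 + ‖ξ‖) ^ τ).mul
      (continuous_cesaroSymbol v η N).norm
  have hI : Integrable (fun ξ => (1 + ‖ξ‖) ^ τ * ‖cesaroSymbol v η N ξ‖) := by
    refine (hi.const_mul D).mono' hcont.aestronglyMeasurable (Eventually.of_forall fun ξ => ?_)
    rw [Real.norm_of_nonneg (by positivity)]
    exact hle ξ
  refine ⟨hI, (integral_mono hI (hi.const_mul D) hle).trans ?_⟩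
  rw [integral_const_mul, he]
  gcongr

/-- The Cesàro cut-offs are uniformly bounded multipliers of a TMIB. -/
theorem TMIB.exists_norm_incl_cesaroCutoff_le {E : Type*} [NormedAddCommGroup E] [NormedSpace ℂ E]
    [CompleteSpace E] (h : TMIB n E) (v : Module.Basis (Fin n) ℝ (Rn n)) (η : 𝓢(Rn n, ℂ)) :
    ∃ C : ℝ, 0 ≤ C ∧ ∀ (N : ℕ) (φ : 𝓢(Rn n, ℂ)),
      ‖h.incl (SchwartzMap.smulLeftCLM ℂ (cesaroCutoff v η N) φ)‖ ≤ C * ‖h.incl φ‖ := by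
  obtain ⟨C, hC, τ, hmul⟩ := h.exists_norm_incl_smulLeftCLM_le
  obtain ⟨D, hD, hsym⟩ := exists_integral_cesaroSymbol_le v η τ
  refine ⟨C * D, by positivity, fun N φ => ?_⟩
  refine (hmul _ (continuous_cesaroSymbol v η N) (hsym N).1 _
    (cesaroCutoff v η N).hasTemperateGrowth (cesaroCutoff_eq_integral v η N) φ).trans ?_
  gcongr
  exact (hsym N).2

/-! ### Regularity of Cesàro summation -/

lemma tendsto_cesaroWeight (k : ℤ) : Tendsto (fun N : ℕ => cesaroWeight N k) atTop (𝓝 1) := by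
  simpa [cesaroWeight] using
    (tendsto_const_div_atTop_nhds_zero_nat |(k : ℝ)|).const_sub 1

lemma norm_prod_cesaroWeight_le {N : ℕ} {m : Fin n → ℤ}
    (hm : m ∈ Fintype.piFinset (fun _ : Fin n => Finset.Ioo (-(N : ℤ)) (N : ℤ))) :
    ‖((∏ j, cesaroWeight N (m j) : ℝ) : ℂ)‖ ≤ 1 := by
  rw [Complex.norm_real, norm_prod]
  refine Finset.prod_le_one (fun _ _ => norm_nonneg _) fun j _ => ?_
  have h1 := Finset.mem_Ioo.1 (Fintype.mem_piFinset.1 hm j)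
  have h2 : |m j| < N := abs_lt.2 h1
  have h3 : |(m j : ℝ)| < N := by exact_mod_cast h2
  have hN : (0 : ℝ) < N := (abs_nonneg _).trans_lt h3
  have h4 : |(m j : ℝ)| / N ≤ 1 := (div_le_one hN).2 h3.le
  have h5 : 0 ≤ |(m j : ℝ)| / N := by positivity
  rw [cesaroWeight, Real.norm_eq_abs, abs_le]
  constructor <;> linarith

/-- Cesàro summation is regular: an absolutely convergent series is Cesàro summable to its sum. -/
lemma hasCesaroSum_of_summable_norm {Λ : Submodule ℤ (Rn n)} (b : Module.Basis (Fin n) ℤ Λ)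
    {X : Type*} [NormedAddCommGroup X] [NormedSpace ℂ X] [CompleteSpace X] {x : Λ → X}
    (hx : Summable fun μ => ‖x μ‖) : HasCesaroSum b x (∑' μ, x μ) := by
  have he : ∀ m : Fin n → ℤ, b.equivFun.symm m = ∑ j, m j • b j := b.equivFun_symm_apply
  have hsum : ∑' μ, x μ = ∑' m : Fin n → ℤ, x (∑ j, m j • b j) := by
    rw [← b.equivFun.symm.toEquiv.tsum_eq]
    simp [he]
  have hsummable : Summable fun m : Fin n → ℤ => ‖x (∑ j, m j • b j)‖ := by
    have := (b.equivFun.symm.toEquiv.summable_iff (f := fun μ => ‖x μ‖)).2 hx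
    refine this.congr fun m => ?_
    simp [he]
  classical
  let F : ℕ → (Fin n → ℤ) → X := fun N m =>
    if m ∈ Fintype.piFinset (fun _ : Fin n => Finset.Ioo (-(N : ℤ)) (N : ℤ)) then
      ((∏ j, cesaroWeight N (m j) : ℝ) : ℂ) • x (∑ j, m j • b j) else 0
  have hF : ∀ N, ∑' m, F N m
      = ∑ m ∈ Fintype.piFinset (fun _ : Fin n => Finset.Ioo (-(N : ℤ)) (N : ℤ)),
        ((∏ j, cesaroWeight N (m j) : ℝ) : ℂ) • x (∑ j, m j • b j) := by
    intro N
    rw [tsum_eq_sum (s := Fintype.piFinset (fun _ : Fin n => Finset.Ioo (-(N : ℤ)) (N : ℤ)))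
      fun m hm => if_neg hm]
    exact Finset.sum_congr rfl fun m hm => if_pos hm
  have hlim : Tendsto (fun N => ∑' m, F N m) atTop (𝓝 (∑' μ, x μ)) := by
    rw [hsum]
    refine tendsto_tsum_of_dominated_convergence hsummable (fun m => ?_)
      (Eventually.of_forall fun N m => ?_)
    · have h1 : Tendsto (fun N : ℕ => ((∏ j, cesaroWeight N (m j) : ℝ) : ℂ) •
          x (∑ j, m j • b j)) atTop (𝓝 (x (∑ j, m j • b j))) := by
        have h2 : Tendsto (fun N : ℕ => ∏ j, cesaroWeight N (m j)) atTop (𝓝 1) := by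
          simpa using tendsto_finsetProd Finset.univ fun j _ => tendsto_cesaroWeight (m j)
        have h3 := ((Complex.continuous_ofReal.tendsto _).comp h2).smul_const (x (∑ j, m j • b j))
        simpa using h3
      refine h1.congr' ?_
      have h4 : ∀ᶠ N : ℕ in atTop, ∀ j, |m j| < N := by
        rw [eventually_all]
        intro j
        exact tendsto_natCast_atTop_atTop.eventually_gt_atTop |m j|
      filter_upwards [h4] with N hN
      refine (if_pos ?_).symm
      exact Fintype.mem_piFinset.2 fun j => Finset.mem_Ioo.2 (abs_lt.1 (hN j))
    · by_cases hm : m ∈ Fintype.piFinset (fun _ : Fin n => Finset.Ioo (-(N : ℤ)) (N : ℤ))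
      · simp only [F, if_pos hm, norm_smul]
        exact mul_le_of_le_one_left (norm_nonneg _) (norm_prod_cesaroWeight_le hm)
      · simp only [F, if_neg hm, norm_zero]
        exact norm_nonneg _
  exact hlim.congr hF

/-! ### Localization of the synthesized series -/

lemma exists_schwartz_eq_one_on_tsupport {U : Opens (Rn n)}
    (hU : Bornology.IsBounded (U : Set (Rn n))) (χ : 𝓓(U, ℂ)) :
    ∃ η : 𝓢(Rn n, ℂ), HasCompactSupport η ∧ (∀ t ∉ U, η t = 0) ∧
      ∀ t, testToSchwartz χ t ≠ 0 → η t = 1 := by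
  obtain ⟨f, h1, h0, -⟩ := exists_contMDiffMap_one_nhds_of_subset_interior (n := ⊤)
    (I := 𝓘(ℝ, Rn n)) (s := tsupport χ) (t := U) (isClosed_tsupport _)
    (by rw [U.isOpen.interior_eq]; exact χ.tsupport_subset)
  have hsupp : Function.support (fun t => ((f t : ℝ) : ℂ)) ⊆ U := by
    intro t ht
    by_contra htU
    exact ht (by simp [h0 t htU])
  have hcs : HasCompactSupport fun t => ((f t : ℝ) : ℂ) := by
    refine HasCompactSupport.intro hU.isCompact_closure fun t ht => ?_
    by_contra hne
    exact ht (subset_closure (hsupp hne))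
  have hcd : ContDiff ℝ ∞ fun t => ((f t : ℝ) : ℂ) :=
    Complex.ofRealCLM.contDiff.comp f.contMDiff.contDiff
  refine ⟨hcs.toSchwartzMap hcd, hcs, fun t ht => ?_, fun t ht => ?_⟩
  · change ((f t : ℝ) : ℂ) = 0
    simp [h0 t ht]
  · change ((f t : ℝ) : ℂ) = 1
    have h2 : f t = 1 := h1.self_of_nhdsSet t (subset_tsupport _ ht)
    simp [h2]

lemma hasCompactSupport_cesaroCutoff (v : Fin n → Rn n) {η : 𝓢(Rn n, ℂ)}
    (hη : HasCompactSupport η) (N : ℕ) : HasCompactSupport (cesaroCutoff v η N) := by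
  unfold cesaroCutoff
  refine Finset.sum_induction _ (fun f : 𝓢(Rn n, ℂ) => HasCompactSupport f)
    (fun f g hf hg => hf.add hg) HasCompactSupport.zero fun m _ => ?_
  have h1 : HasCompactSupport (translate (∑ j, m j • v j) η) :=
    hη.comp_homeomorph (Homeomorph.subRight (∑ j, m j • v j))
  exact h1.smul_left (f := fun _ => ((∏ j, cesaroWeight N (m j) : ℝ) : ℂ))

lemma hasCompactSupport_smulLeftCLM {g : Rn n → ℂ} (hg : HasCompactSupport g) (φ : 𝓢(Rn n, ℂ)) :
    HasCompactSupport (SchwartzMap.smulLeftCLM ℂ g φ) :=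
  IsCompact.of_isClosed_subset hg (isClosed_tsupport _)
    ((SchwartzMap.tsupport_smulLeftCLM_subset g φ).trans Set.inter_subset_right)

/-- As the sets `λ + U` are disjoint, the translate `η(· - ν)` is `1` on the support of `T^B_μ χ`
if `ν = μ`, and `0` there otherwise. -/
lemma twistedTranslate_mul_translate (B : Matrix (Fin n) (Fin n) ℝ) {Λ : Submodule ℤ (Rn n)}
    {U : Opens (Rn n)}
    (hdisj : Pairwise fun μ ν : Λ =>
      Disjoint ((μ : Rn n) +ᵥ (U : Set (Rn n))) ((ν : Rn n) +ᵥ (U : Set (Rn n))))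
    {χ : 𝓓(U, ℂ)} {η : 𝓢(Rn n, ℂ)} (hη0 : ∀ t ∉ U, η t = 0)
    (hη1 : ∀ t, testToSchwartz χ t ≠ 0 → η t = 1) (μ ν : Λ) (t : Rn n) :
    twistedTranslate B (μ : Rn n) (testToSchwartz χ) t * η (t - ν)
      = if ν = μ then twistedTranslate B (μ : Rn n) (testToSchwartz χ) t else 0 := by
  by_cases hχ : testToSchwartz χ (t - μ) = 0
  · simp [twistedTranslate_apply, hχ]
  have hU : t - μ ∈ U := χ.tsupport_subset (subset_tsupport _ hχ)
  split_ifs with h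
  · rw [h, hη1 _ hχ, mul_one]
  · have h1 : t - ν ∉ U := by
      intro h2
      have h3 : t ∈ (ν : Rn n) +ᵥ (U : Set (Rn n)) := Set.mem_vadd_set.2 ⟨t - ν, h2, by simp⟩
      have h4 : t ∈ (μ : Rn n) +ᵥ (U : Set (Rn n)) := Set.mem_vadd_set.2 ⟨t - μ, hU, by simp⟩
      exact Set.disjoint_left.1 (hdisj h) h3 h4
    rw [hη0 _ h1, mul_zero]

/-- Multiplication of `S_χ(c)` by the Cesàro cut-off produces the Cesàro means of the series. -/
lemma IsSynthesis.apply_cesaroCutoff {B : Matrix (Fin n) (Fin n) ℝ} {Λ : Submodule ℤ (Rn n)}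
    (b : Module.Basis (Fin n) ℤ Λ) {U : Opens (Rn n)}
    (hdisj : Pairwise fun μ ν : Λ =>
      Disjoint ((μ : Rn n) +ᵥ (U : Set (Rn n))) ((ν : Rn n) +ᵥ (U : Set (Rn n))))
    {χ : 𝓓(U, ℂ)} {η : 𝓢(Rn n, ℂ)} (hη : HasCompactSupport η) (hη0 : ∀ t ∉ U, η t = 0)
    (hη1 : ∀ t, testToSchwartz χ t ≠ 0 → η t = 1) {c : Λ → ℂ} {u : TempDist n}
    (hu : IsSynthesis B Λ (testToSchwartz χ) c u) (N : ℕ) (ψ : 𝓢(Rn n, ℂ)) :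
    u (SchwartzMap.smulLeftCLM ℂ (cesaroCutoff (fun j => (b j : Rn n)) η N) ψ)
      = ∑ m ∈ Fintype.piFinset (fun _ : Fin n => Finset.Ioo (-(N : ℤ)) (N : ℤ)),
        ((∏ j, cesaroWeight N (m j) : ℝ) : ℂ) * (c (∑ j, m j • b j) *
          ∫ t, twistedTranslate B ((∑ j, m j • b j : Λ) : Rn n) (testToSchwartz χ) t * ψ t) := by
  classical
  set G := cesaroCutoff (fun j => (b j : Rn n)) η N with hG
  have h1 := hu _ (hasCompactSupport_smulLeftCLM
    (hasCompactSupport_cesaroCutoff (fun j => (b j : Rn n)) hη N) ψ)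
  rw [← hG] at h1
  refine h1.unique ?_
  have hpt : ∀ m : Fin n → ℤ, ((∑ j, m j • b j : Λ) : Rn n) = ∑ j, m j • (b j : Rn n) := by
    intro m; simp
  have h2 : ∀ (μ : Λ) (t : Rn n), twistedTranslate B (μ : Rn n) (testToSchwartz χ) t *
      SchwartzMap.smulLeftCLM ℂ G ψ t
      = (∑ m ∈ Fintype.piFinset (fun _ : Fin n => Finset.Ioo (-(N : ℤ)) (N : ℤ)),
        ((∏ j, cesaroWeight N (m j) : ℝ) : ℂ) * if ∑ j, m j • b j = μ then 1 else 0) *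
        (twistedTranslate B (μ : Rn n) (testToSchwartz χ) t * ψ t) := by
    intro μ t
    rw [SchwartzMap.smulLeftCLM_apply_apply G.hasTemperateGrowth, smul_eq_mul, hG,
      cesaroCutoff_apply, Finset.sum_mul, Finset.mul_sum, Finset.sum_mul]
    refine Finset.sum_congr rfl fun m _ => ?_
    have h3 := twistedTranslate_mul_translate B hdisj hη0 hη1 μ (∑ j, m j • b j) t
    rw [hpt] at h3
    calc _ = ((∏ j, cesaroWeight N (m j) : ℝ) : ℂ) * (twistedTranslate B (μ : Rn n)
          (testToSchwartz χ) t * η (t - ∑ j, m j • (b j : Rn n))) * ψ t := by ring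
      _ = _ := by
        rw [h3]
        split_ifs <;> ring
  simp_rw [h2, integral_const_mul, Finset.sum_mul, Finset.mul_sum]
  refine hasSum_sum fun m _ => ?_
  have h4 := hasSum_ite_eq (∑ j, m j • b j)
    (((∏ j, cesaroWeight N (m j) : ℝ) : ℂ) * (c (∑ j, m j • b j) *
      ∫ t, twistedTranslate B ((∑ j, m j • b j : Λ) : Rn n) (testToSchwartz χ) t * ψ t))
  convert h4 using 2 with μ
  by_cases h : ∑ j, m j • b j = μ
  · subst h
    simp
    ring
  · simp [h, Ne.symm h]

/-- Tested against a compactly supported function, the Cesàro means of `S_χ(c)` converge. -/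
lemma IsSynthesis.tendsto_cesaroCutoff {B : Matrix (Fin n) (Fin n) ℝ} {Λ : Submodule ℤ (Rn n)}
    (b : Module.Basis (Fin n) ℤ Λ) {U : Opens (Rn n)}
    (hdisj : Pairwise fun μ ν : Λ =>
      Disjoint ((μ : Rn n) +ᵥ (U : Set (Rn n))) ((ν : Rn n) +ᵥ (U : Set (Rn n))))
    {χ : 𝓓(U, ℂ)} {η : 𝓢(Rn n, ℂ)} (hη : HasCompactSupport η) (hη0 : ∀ t ∉ U, η t = 0)
    (hη1 : ∀ t, testToSchwartz χ t ≠ 0 → η t = 1) {c : Λ → ℂ} {u : TempDist n}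
    (hu : IsSynthesis B Λ (testToSchwartz χ) c u) {ψ : 𝓢(Rn n, ℂ)} (hψ : HasCompactSupport ψ) :
    Tendsto (fun N : ℕ =>
      u (SchwartzMap.smulLeftCLM ℂ (cesaroCutoff (fun j => (b j : Rn n)) η N) ψ)) atTop
      (𝓝 (u ψ)) := by
  simp_rw [hu.apply_cesaroCutoff b hdisj hη hη0 hη1]
  have h1 := hasCesaroSum_of_summable_norm b (hu ψ hψ).summable.norm
  rw [(hu ψ hψ).tsum_eq] at h1
  exact h1

/-! ### Strong convergence of the Cesàro operators -/

namespace TMIB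

variable {E : Type*} [NormedAddCommGroup E] [NormedSpace ℂ E] [CompleteSpace E]

lemma dense_incl_hasCompactSupport (h : TMIB n E) :
    Dense (h.incl '' {φ : 𝓢(Rn n, ℂ) | HasCompactSupport φ}) :=
  h.denseRange_incl.dense_image h.incl.continuous (dense_hasCompactSupport n)

lemma emb_incl_smulLeftCLM (h : TMIB n E) {g : Rn n → ℂ} (hg : g.HasTemperateGrowth)
    (φ ψ : 𝓢(Rn n, ℂ)) :
    h.emb (h.incl (SchwartzMap.smulLeftCLM ℂ g φ)) ψ
      = h.emb (h.incl φ) (SchwartzMap.smulLeftCLM ℂ g ψ) := by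
  rw [h.emb_incl, h.emb_incl]
  congr 1
  ext t
  simp only [SchwartzMap.smulLeftCLM_apply_apply hg, smul_eq_mul]
  ring

/-- On compactly supported functions only finitely many terms of the Cesàro cut-offs matter, and
multiplication by the cut-offs converges. -/
lemma exists_tendsto_incl_cesaroCutoff (h : TMIB n E) {Λ : Submodule ℤ (Rn n)}
    [DiscreteTopology Λ] [IsZLattice ℝ Λ] (b : Module.Basis (Fin n) ℤ Λ) {η : 𝓢(Rn n, ℂ)}
    (hη : HasCompactSupport η) {φ : 𝓢(Rn n, ℂ)} (hφ : HasCompactSupport φ) :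
    ∃ e : E, Tendsto (fun N : ℕ => h.incl
      (SchwartzMap.smulLeftCLM ℂ (cesaroCutoff (fun j => (b j : Rn n)) η N) φ)) atTop (𝓝 e) := by
  let x : Λ → E := fun μ => h.incl (SchwartzMap.smulLeftCLM ℂ (translate (μ : Rn n) η) φ)
  have hfin : (Function.support fun μ => ‖x μ‖).Finite := by
    have hbd : Bornology.IsBounded (tsupport φ - tsupport η) :=
      (IsCompact.isBounded hφ).sub (IsCompact.isBounded hη)
    have h1 := ZSpan.setFinite_inter (b.ofZLatticeBasis ℝ Λ) hbd
    rw [Module.Basis.ofZLatticeBasis_span] at h1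
    refine Set.Finite.of_finite_image (f := ((↑) : Λ → Rn n)) (h1.subset ?_)
      Subtype.val_injective.injOn
    rintro _ ⟨μ, hμ, rfl⟩
    refine ⟨?_, μ.2⟩
    by_contra hnot
    refine hμ ?_
    have h2 : SchwartzMap.smulLeftCLM ℂ (translate (μ : Rn n) η) φ = 0 := by
      ext t
      rw [SchwartzMap.smulLeftCLM_apply_apply (translate (μ : Rn n) η).hasTemperateGrowth,
        translate_apply]
      by_contra hne
      refine hnot ?_
      have h3 : η (t - μ) ≠ 0 := fun h0 => hne (by simp [h0])
      have h4 : φ t ≠ 0 := fun h0 => hne (by simp [h0])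
      exact Set.mem_sub.2 ⟨t, subset_tsupport _ h4, t - μ, subset_tsupport _ h3, by simp⟩
    simp [x, h2]
  have h1 := hasCesaroSum_of_summable_norm b (x := x) (summable_of_hasFiniteSupport hfin)
  refine ⟨_, h1.congr fun N => ?_⟩
  have hG : (⇑(cesaroCutoff (fun j => (b j : Rn n)) η N) : Rn n → ℂ)
      = fun t => ∑ m ∈ Fintype.piFinset (fun _ : Fin n => Finset.Ioo (-(N : ℤ)) (N : ℤ)),
        (((∏ j, cesaroWeight N (m j) : ℝ) : ℂ) • ⇑(translate (∑ j, m j • (b j : Rn n)) η)) t := by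
    ext t
    rw [cesaroCutoff_apply]
    rfl
  have htg : ∀ s : Rn n, Function.HasTemperateGrowth (translate s η) :=
    fun s => (translate s η).hasTemperateGrowth
  rw [hG, SchwartzMap.smulLeftCLM_sum fun m _ =>
    (Function.HasTemperateGrowth.const (E := Rn n) (((∏ j, cesaroWeight N (m j) : ℝ) : ℂ))).mul
      (htg (∑ j, m j • (b j : Rn n)))]
  rw [_root_.sum_apply, map_sum]
  refine Finset.sum_congr rfl fun m _ => ?_
  rw [SchwartzMap.smulLeftCLM_smul (htg _)]
  simp [x, cesaroWeight]

/-- The multiplications by the Cesàro cut-offs extend to bounded operators of a TMIB, which converge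
strongly. -/
theorem exists_cesaro_operators (h : TMIB n E) {Λ : Submodule ℤ (Rn n)}
    [DiscreteTopology Λ] [IsZLattice ℝ Λ] (b : Module.Basis (Fin n) ℤ Λ) {η : 𝓢(Rn n, ℂ)}
    (hη : HasCompactSupport η) :
    ∃ (K : ℕ → E →L[ℂ] E) (P : E →L[ℂ] E),
      (∀ N φ, K N (h.incl φ) = h.incl
        (SchwartzMap.smulLeftCLM ℂ (cesaroCutoff (fun j => (b j : Rn n)) η N) φ)) ∧
      ∀ e, Tendsto (fun N => K N e) atTop (𝓝 (P e)) := by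
  obtain ⟨C, hC, hbound⟩ := h.exists_norm_incl_cesaroCutoff_le (b.ofZLatticeBasis ℝ Λ) η
  have hv : (⇑(b.ofZLatticeBasis ℝ Λ) : Fin n → Rn n) = fun j => (b j : Rn n) := by
    ext1 j
    exact b.ofZLatticeBasis_apply ℝ Λ j
  rw [hv] at hbound
  let M : ℕ → 𝓢(Rn n, ℂ) →ₗ[ℂ] E := fun N => (h.incl.comp
    (SchwartzMap.smulLeftCLM ℂ (cesaroCutoff (fun j => (b j : Rn n)) η N))).toLinearMap
  let K : ℕ → E →L[ℂ] E := fun N => (M N).extendOfNorm h.incl.toLinearMap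
  have hK : ∀ N φ, K N (h.incl φ) = h.incl
        (SchwartzMap.smulLeftCLM ℂ (cesaroCutoff (fun j => (b j : Rn n)) η N) φ) := fun N φ =>
    LinearMap.extendOfNorm_eq (f := M N) (e := h.incl.toLinearMap) h.denseRange_incl
      ⟨C, hbound N⟩ φ
  have hKn : ∀ N e, ‖K N e‖ ≤ C * ‖e‖ := fun N e =>
    LinearMap.norm_extendOfNorm_apply_le (f := M N) (e := h.incl.toLinearMap) h.denseRange_incl C
      (hbound N) e
  -- uniform boundedness transfers the Cauchy property from a dense subset to the whole space
  have hcauchy : ∀ e, CauchySeq fun N => K N e := by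
    intro e
    rw [Metric.cauchySeq_iff']
    intro ε hε
    obtain ⟨-, ⟨φ, hφ, rfl⟩, hd⟩ := h.dense_incl_hasCompactSupport.exists_dist_lt e
      (ε := ε / (4 * (C + 1))) (by positivity)
    obtain ⟨l, hl⟩ := h.exists_tendsto_incl_cesaroCutoff b hη hφ
    obtain ⟨N₀, hN₀⟩ := Metric.cauchySeq_iff'.1 hl.cauchySeq (ε / 2) (by positivity)
    refine ⟨N₀, fun N hN => ?_⟩
    have h1 : ∀ N, dist (K N e) (K N (h.incl φ)) ≤ ε / 4 := by
      intro N
      rw [dist_eq_norm, ← map_sub]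
      refine (hKn N _).trans ?_
      rw [dist_eq_norm] at hd
      calc C * ‖e - h.incl φ‖ ≤ (C + 1) * (ε / (4 * (C + 1))) := by gcongr; linarith
        _ = ε / 4 := by field_simp
    have h2 := hN₀ N hN
    rw [← hK, ← hK] at h2
    have h3 := h1 N
    have h4 := h1 N₀
    rw [dist_comm] at h4
    have h5 := dist_triangle4 (K N e) (K N (h.incl φ)) (K N₀ (h.incl φ)) (K N₀ e)
    linarith
  choose f hf using fun e => cauchySeq_tendsto_of_complete (hcauchy e)
  exact ⟨K, continuousLinearMapOfTendsto K (tendsto_pi_nhds.2 hf), hK, hf⟩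

/-! ### Cesàro summability in a TMIB and in a DTMIB -/

/-- In a TMIB, the series of a synthesized element is Cesàro summable in norm. -/
theorem hasCesaroSum_of_isSynthesis (h : TMIB n E) {B : Matrix (Fin n) (Fin n) ℝ}
    {Λ : Submodule ℤ (Rn n)} [DiscreteTopology Λ] [IsZLattice ℝ Λ]
    (b : Module.Basis (Fin n) ℤ Λ) {U : Opens (Rn n)}
    (hU : Bornology.IsBounded (U : Set (Rn n)))
    (hdisj : Pairwise fun μ ν : Λ =>
      Disjoint ((μ : Rn n) +ᵥ (U : Set (Rn n))) ((ν : Rn n) +ᵥ (U : Set (Rn n))))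
    {χ : 𝓓(U, ℂ)} {c : Λ → ℂ} {e : E} (he : IsSynthesis B Λ (testToSchwartz χ) c (h.emb e)) :
    HasCesaroSum b (fun μ : Λ => c μ • h.incl (twistedTranslate B (μ : Rn n) (testToSchwartz χ)))
      e := by
  obtain ⟨η, hη, hη0, hη1⟩ := exists_schwartz_eq_one_on_tsupport hU χ
  obtain ⟨K, P, hK, hP⟩ := h.exists_cesaro_operators b hη
  let G : ℕ → 𝓢(Rn n, ℂ) := cesaroCutoff (fun j => (b j : Rn n)) η
  have hKe : ∀ N ψ, h.emb (K N e) ψ = h.emb e (SchwartzMap.smulLeftCLM ℂ (G N) ψ) := by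
    intro N ψ
    have h1 : (fun e => h.dualIncl ψ (K N e))
        = fun e => h.dualIncl (SchwartzMap.smulLeftCLM ℂ (G N) ψ) e := by
      refine h.denseRange_incl.equalizer ((h.dualIncl ψ).continuous.comp (K N).continuous)
        (h.dualIncl _).continuous ?_
      ext φ
      simp only [Function.comp_apply, h.dualIncl_apply, hK]
      exact h.emb_incl_smulLeftCLM (G N).hasTemperateGrowth φ ψ
    exact congrFun h1 e
  -- the limit of `K N e` is `e`: they agree as distributions on compactly supported functions
  have hPe : P e = e := by
    refine h.injective_emb (DFunLike.coe_injective ?_)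
    refine Continuous.ext_on (dense_hasCompactSupport n) (h.emb (P e)).continuous
      (h.emb e).continuous fun ψ hψ => ?_
    have h1 := he.tendsto_cesaroCutoff b hdisj hη hη0 hη1 hψ
    have h2 := ((h.dualIncl ψ).continuous.tendsto _).comp (hP e)
    exact tendsto_nhds_unique h2 (h1.congr fun N => (hKe N ψ).symm)
  have hlim := hP e
  rw [hPe] at hlim
  refine hlim.congr fun N => h.injective_emb ?_
  ext ψ
  rw [hKe, he.apply_cesaroCutoff b hdisj hη hη0 hη1, map_sum, _root_.sum_apply]
  refine Finset.sum_congr rfl fun m _ => ?_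
  rw [map_smul, map_smul, _root_.smul_apply, _root_.smul_apply, h.emb_incl]
  rfl

/-- In a DTMIB, the series of a synthesized element is weak-* Cesàro summable: its Cesàro means are
obtained by composing the functional with the operators extending multiplication by the Cesàro
cut-offs on the predual. -/
theorem hasCesaroSum_toWeakDual_of_isSynthesis (h : TMIB n E) {B : Matrix (Fin n) (Fin n) ℝ}
    {Λ : Submodule ℤ (Rn n)} [DiscreteTopology Λ] [IsZLattice ℝ Λ]
    (b : Module.Basis (Fin n) ℤ Λ) {U : Opens (Rn n)}
    (hU : Bornology.IsBounded (U : Set (Rn n)))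
    (hdisj : Pairwise fun μ ν : Λ =>
      Disjoint ((μ : Rn n) +ᵥ (U : Set (Rn n))) ((ν : Rn n) +ᵥ (U : Set (Rn n))))
    {χ : 𝓓(U, ℂ)} {c : Λ → ℂ} {e' : StrongDual ℂ E}
    (he : IsSynthesis B Λ (testToSchwartz χ) c (h.dualEmb e')) :
    HasCesaroSum b (fun μ : Λ => c μ • StrongDual.toWeakDual
      (h.dualIncl (twistedTranslate B (μ : Rn n) (testToSchwartz χ)))) (StrongDual.toWeakDual e') := by
  obtain ⟨η, hη, hη0, hη1⟩ := exists_schwartz_eq_one_on_tsupport hU χ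
  obtain ⟨K, P, hK, hP⟩ := h.exists_cesaro_operators b hη
  have hPe : ∀ e, e' (P e) = e' e := by
    refine congrFun (Continuous.ext_on h.dense_incl_hasCompactSupport
      (e'.continuous.comp P.continuous) e'.continuous ?_)
    rintro - ⟨φ, hφ, rfl⟩
    have h1 := he.tendsto_cesaroCutoff b hdisj hη hη0 hη1 hφ
    have h2 := (e'.continuous.tendsto _).comp (hP (h.incl φ))
    refine tendsto_nhds_unique h2 (h1.congr fun N => ?_)
    simp only [Function.comp_apply, hK]
    rfl
  have hsum : ∀ N : ℕ, e'.comp (K N)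
      = ∑ m ∈ Fintype.piFinset (fun _ : Fin n => Finset.Ioo (-(N : ℤ)) (N : ℤ)),
        ((∏ j, cesaroWeight N (m j) : ℝ) : ℂ) • c (∑ j, m j • b j) • h.dualIncl
          (twistedTranslate B ((∑ j, m j • b j : Λ) : Rn n) (testToSchwartz χ)) := by
    intro N
    refine h.dualEmb_injective ?_
    ext ψ
    have h1 := he.apply_cesaroCutoff b hdisj hη hη0 hη1 N ψ
    rw [h.dualEmb_apply] at h1
    rw [h.dualEmb_apply, ContinuousLinearMap.comp_apply, hK, h1, map_sum, _root_.sum_apply]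
    refine Finset.sum_congr rfl fun m _ => ?_
    rw [map_smul, map_smul, _root_.smul_apply, _root_.smul_apply, h.dualEmb_dualIncl]
    rfl
  refine tendsto_iff_forall_eval_tendsto_topDualPairing.2 fun e => ?_
  have h1 := (e'.continuous.tendsto _).comp (hP e)
  rw [hPe] at h1
  refine h1.congr fun N => ?_
  have h2 := congrArg (fun f : StrongDual ℂ E => f e) (hsum N)
  simp only [ContinuousLinearMap.comp_apply] at h2
  rw [Function.comp_apply, h2]
  rfl

end TMIB

end GaborTMIB

end

theorem theorem5p15 {n : ℕ} (B : Matrix (Fin n) (Fin n) ℝ)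
    (Λ : Submodule ℤ (GaborTMIB.Rn n)) [DiscreteTopology Λ] [IsZLattice ℝ Λ]
    (b : Module.Basis (Fin n) ℤ Λ)
    (U : Opens (GaborTMIB.Rn n)) (hUb : Bornology.IsBounded (U : Set (GaborTMIB.Rn n)))
    (hU0 : (0 : GaborTMIB.Rn n) ∈ U)
    (hdisj : Pairwise fun μ ν : Λ =>
      Disjoint ((μ : GaborTMIB.Rn n) +ᵥ (U : Set (GaborTMIB.Rn n)))
        ((ν : GaborTMIB.Rn n) +ᵥ (U : Set (GaborTMIB.Rn n))))
    (χ : 𝓓(U, ℂ)) (hχ : χ ≠ 0)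
    {E : Type*} [NormedAddCommGroup E] [NormedSpace ℂ E] [CompleteSpace E]
    (hE : GaborTMIB.TMIB n E) :
    -- the TMIB `E`, with its norm topology
    (∀ c ∈ GaborTMIB.discreteSpace hE.emb B Λ (GaborTMIB.testToSchwartz χ),
      ∃ e : E, GaborTMIB.IsSynthesis B Λ (GaborTMIB.testToSchwartz χ) c (hE.emb e) ∧
        GaborTMIB.HasCesaroSum b
          (fun μ : Λ => c μ • hE.incl
            (GaborTMIB.twistedTranslate B (μ : GaborTMIB.Rn n) (GaborTMIB.testToSchwartz χ)))
          e) ∧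
    -- the DTMIB `E'`, with its weak-* topology
    (∀ c ∈ GaborTMIB.discreteSpace hE.dualEmb B Λ (GaborTMIB.testToSchwartz χ),
      ∃ e : StrongDual ℂ E,
        GaborTMIB.IsSynthesis B Λ (GaborTMIB.testToSchwartz χ) c (hE.dualEmb e) ∧
        GaborTMIB.HasCesaroSum b
          (fun μ : Λ => c μ • StrongDual.toWeakDual (hE.dualIncl
            (GaborTMIB.twistedTranslate B (μ : GaborTMIB.Rn n) (GaborTMIB.testToSchwartz χ))))
          (StrongDual.toWeakDual e)) := by
  exact ⟨fun c ⟨e, he⟩ => ⟨e, he, hE.hasCesaroSum_of_isSynthesis b hUb hdisj he⟩,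
    fun c ⟨e, he⟩ => ⟨e, he, hE.hasCesaroSum_toWeakDual_of_isSynthesis b hUb hdisj he⟩⟩
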